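/- Let $S$ be a non-empty scheme on which $2$ is invertible and let $n\ge 0$ be an integer. An Azumaya algebra over a scheme $X$ is an $\mathcal{O}_X$-algebra $\mathcal{A}$, locally free of finite (nowhere zero) rank as an $\mathcal{O}_X$-module, such that $\mathcal{A}\otimes\mathcal{A}^{op}\to \mathcal{E}nd_{\mathcal{O}_X}(\mathcal{A})$, $a\otimes b\mapsto (x\mapsto axb)$, is an isomorphism; it has degree $n$ if there is an étale covering $\{U_i\to X\}$ with $\mathcal{A}|_{U_i}\simeq \mathcal{M}_n(\mathcal{O}_{U_i})$ for all $i$. An involution of an $\mathcal{O}_S$-algebra $\mathcal{A}$ is an isomorphism of $\mathcal{O}_S$-algebras $\sigma:\mathcal{A}\to\mathcal{A}^{op}$ with $\sigma^{op}\circ\sigma=\mathrm{id}$. (1) Let $\mathcal{A}$ be an Azumaya algebra of degree $n$ over $S$ with an involution $\sigma$ of orthogonal type, i.e. étale locally on $S$, $(\mathcal{A},\sigma)$ is isomorphic to the endomorphism algebra of a locally free module of finite rank with the adjoint involution of a non-degenerate symmetric bilinear form with values in a line bundle. Then étale locally on $S$, $(\mathcal{A},\sigma)\simeq(\mathcal{M}_n,\mathrm{tr})$,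 where $\mathrm{tr}$ is the transpose. (2) Let $\mathcal{A}$ be an Azumaya algebra of degree $n$ over $S$ with an involution $\sigma$ of symplectic type, i.e. the same with a non-degenerate skew-symmetric form. Then $n=2m$ is even and étale locally on $S$, $(\mathcal{A},\sigma)\simeq(\mathcal{M}_{2m},\mathrm{sp})$, where $\mathrm{sp}(A)=J_mA^{tr}J_m^{-1}$ and $J_m=\begin{bmatrix}0&I_m\\-I_m&0\end{bmatrix}$. (3) Let $\pi:T\to S$ be a finite étale covering of degree $2$, and let $\tau$ be the non-trivial element of its Galois group (an $S$-automorphism of $T$ which is not the identity over any non-empty open and closed subscheme of $S$). Let $\mathcal{A}$ be an Azumaya algebra of degree $n$ over $T$ with an involution $\sigma$ of unitary type, i.e. an anti-automorphism of order $2$ that restricts to $\tau$ on $\mathcal{O}_T$. Then étale locally on $S$, $(\mathcal{A},\sigma)$, viewed as the $\mathcal{O}_S$-algebra $\pi_*\mathcal{A}$ with its involution, is isomorphic to $(\mathcal{M}_n\times\mathcal{M}_n^{op},\epsilon)$, where $\epsilon(A,B^{op})=(B,A^{op})$ is the exchange involution. -/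

import Mathlib

open CategoryTheory AlgebraicGeometry TensorProduct Opposite

universe u

noncomputable section

namespace AzumayaInvolution

/-! ## Sheaves of algebras over a scheme -/

/-- A sheaf of (associative, unital, not necessarily commutative) `𝒪_S`-algebras: a sheaf of rings
together with a morphism from `𝒪_S` landing in the centre. -/
structure OAlgebra (S : Scheme.{u}) where
  /-- the underlying sheaf of rings -/
  sheaf : TopCat.Sheaf RingCat.{u} S
  /-- the structure morphism -/
  unit : S.ringCatSheaf ⟶ sheaf
  central : ∀ (U : S.Opens) (r : Γ(S, U)) (a : sheaf.obj.obj (op U)),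
    (unit.hom.app (op U)).hom r * a = a * (unit.hom.app (op U)).hom r

namespace OAlgebra

variable {S : Scheme.{u}}

/-- The ring of sections over an open subset. -/
abbrev sections (A : OAlgebra S) (U : S.Opens) : Type u := A.sheaf.obj.obj (op U)

instance (A : OAlgebra S) (U : S.Opens) : Algebra Γ(S, U) (A.sections U) :=
  RingHom.toAlgebra' (A.unit.hom.app (op U)).hom (A.central U)

/-- Restriction of sections. -/
def res (A : OAlgebra S) {V U : S.Opens} (h : V ≤ U) : A.sections U →+* A.sections V :=
  (A.sheaf.obj.map (homOfLE h).op).hom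

/-- `A` is, as an `𝒪_S`-module, locally free of finite rank: every point has an open neighbourhood
`U` over which there are sections `e₁, …, e_r` that form a basis of `A` over every open subset
of `U`, i.e. `A|_U ≅ 𝒪_U ^ r`. -/
def IsLocallyFreeOfFiniteRank (A : OAlgebra S) : Prop :=
  ∀ s : S, ∃ (U : S.Opens) (_ : s ∈ U) (r : ℕ) (e : Fin r → A.sections U),
    ∀ (V : S.Opens) (h : V ≤ U),
      LinearIndependent Γ(S, V) (fun i => A.res h (e i)) ∧
      Submodule.span Γ(S, V) (Set.range fun i => A.res h (e i)) = ⊤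

/-- The direct image of an `𝒪_T`-algebra under `π : T ⟶ S`, as an `𝒪_S`-algebra. -/
def pushforward {T : Scheme.{u}} (π : T ⟶ S) (A : OAlgebra T) : OAlgebra S where
  sheaf := ((TopologicalSpace.Opens.map π.base).sheafPushforwardContinuous _ _ _).obj A.sheaf
  unit := π.toRingCatSheafHom ≫
    ((TopologicalSpace.Opens.map π.base).sheafPushforwardContinuous _ _ _).map A.unit
  central U r a := A.central (π ⁻¹ᵁ U) ((π.app U).hom r) a

end OAlgebra

/-! ## Locality for the étale topology -/

/-- An étale morphism `Spec R ⟶ S` which factors through an affine open subset `V` of `S`. -/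
structure EtaleChart (S : Scheme.{u}) where
  /-- the affine open subset -/
  V : S.Opens
  isAffineOpen : IsAffineOpen V
  /-- the coordinate ring of the source -/
  R : Type u
  [commRing : CommRing R]
  [algebra : Algebra Γ(S, V) R]
  [etale : Algebra.Etale Γ(S, V) R]

attribute [instance] EtaleChart.commRing EtaleChart.algebra EtaleChart.etale

/-- The morphism of schemes `Spec R ⟶ S` of an étale chart. -/
def EtaleChart.map {S : Scheme.{u}} (c : EtaleChart S) : Spec (.of c.R) ⟶ S :=
  Spec.map (CommRingCat.ofHom (algebraMap Γ(S, c.V) c.R)) ≫ c.isAffineOpen.fromSpec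

instance {S : Scheme.{u}} (c : EtaleChart S) : Etale c.map := by
  have : Etale (Spec.map (CommRingCat.ofHom (algebraMap Γ(S, c.V) c.R))) := by
    rw [HasRingHomProperty.Spec_iff (P := @Etale)]
    exact RingHom.etale_algebraMap.mpr c.etale
  unfold EtaleChart.map
  infer_instance

/-- `P` holds locally for the étale topology on `S`: there is an étale covering of `S` by charts
that satisfy `P`. -/
def EtaleLocally (S : Scheme.{u}) (P : EtaleChart S → Prop) : Prop :=
  ∀ s : S, ∃ c : EtaleChart S, s ∈ Set.range c.map ∧ P c

/-- The pullback of a quasi-coherent `𝒪_S`-algebra `A` along an étale chart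
`Spec R ⟶ V ⊆ S`, given by its algebra of global sections `R ⊗ A(V)` over `R`. -/
abbrev OAlgebra.pull {S : Scheme.{u}} (A : OAlgebra S) (c : EtaleChart S) : Type u :=
  c.R ⊗[Γ(S, c.V)] A.sections c.V

/-! ## Azumaya algebras -/

/-- `A` is an Azumaya algebra over `S`: it is locally free of finite rank, and
`A ⊗ A^op ⟶ End(A)`, `a ⊗ b ↦ (x ↦ a x b)` is an isomorphism over each affine open subset. -/
structure OAlgebra.IsAzumaya {S : Scheme.{u}} (A : OAlgebra S) : Prop where
  locallyFree : A.IsLocallyFreeOfFiniteRank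
  azumaya : ∀ V : S.Opens, IsAffineOpen V → _root_.IsAzumaya Γ(S, V) (A.sections V)

/-- `A` is an Azumaya algebra of degree `n`: there is an étale covering on which it becomes
isomorphic to the algebra of `n × n` matrices. -/
structure OAlgebra.IsAzumayaOfDegree {S : Scheme.{u}} (A : OAlgebra S) (n : ℕ) : Prop
    extends A.IsAzumaya where
  degree : EtaleLocally S fun c => Nonempty (A.pull c ≃ₐ[c.R] Matrix (Fin n) (Fin n) c.R)

/-! ## Involutions -/

/-- An `𝒪_S`-linear involution of an `𝒪_S`-algebra: an isomorphism `σ : A ⟶ A^op` of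
`𝒪_S`-algebras with `σ ∘ σ = id`. -/
structure Involution {S : Scheme.{u}} (A : OAlgebra S) where
  /-- the map on sections -/
  app (U : S.Opens) : A.sections U →ₗ[Γ(S, U)] A.sections U
  map_one (U : S.Opens) : app U 1 = 1
  map_mul (U : S.Opens) (a b : A.sections U) : app U (a * b) = app U b * app U a
  app_app (U : S.Opens) (a : A.sections U) : app U (app U a) = a
  naturality {V U : S.Opens} (h : V ≤ U) (a : A.sections U) :
    A.res h (app U a) = app V (A.res h a)

/-- The pullback of an involution along an étale chart. -/
def Involution.pull {S : Scheme.{u}} {A : OAlgebra S} (σ : Involution A) (c : EtaleChart S) :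
    A.pull c →ₗ[c.R] A.pull c :=
  (σ.app c.V).baseChange c.R

/-- Over a commutative ring `R` and for `ε = ± 1`: the algebra with involution `(B, σ)` is
isomorphic to `(End E, adjoint involution of b)` for some `b : E × E → L`, where `E` is a finitely
generated projective `R`-module, `L` is an invertible `R`-module, and `b` is a non-degenerate
bilinear form with `b (y, x) = ε b (x, y)`. -/
def IsAdjointInvolution (R : Type u) [CommRing R] (ε : ℤˣ) {B : Type u} [Ring B] [Algebra R B]
    (σ : B →ₗ[R] B) : Prop :=
  ∃ (E L : Type u) (_ : AddCommGroup E) (_ : Module R E) (_ : AddCommGroup L) (_ : Module R L)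
    (b : E →ₗ[R] E →ₗ[R] L) (e : B ≃ₐ[R] Module.End R E),
    Module.Finite R E ∧ Module.Projective R E ∧ Module.Invertible R L ∧
    Function.Bijective b ∧
    (∀ x y, b y x = (ε : ℤ) • b x y) ∧
    ∀ a x y, b (e a x) y = b x (e (σ a) y)

/-- Orthogonal type: étale locally, `σ` corresponds to a non-degenerate symmetric bilinear form
on a locally free module, with values in a line bundle. -/
def Involution.IsOrthogonal {S : Scheme.{u}} {A : OAlgebra S} (σ : Involution A) : Prop :=
  EtaleLocally S fun c => IsAdjointInvolution c.R 1 (σ.pull c)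

/-- Symplectic type: étale locally, `σ` corresponds to a non-degenerate skew-symmetric bilinear
form on a locally free module, with values in a line bundle. -/
def Involution.IsSymplectic {S : Scheme.{u}} {A : OAlgebra S} (σ : Involution A) : Prop :=
  EtaleLocally S fun c => IsAdjointInvolution c.R (-1) (σ.pull c)

/-- `π : T ⟶ S` is an étale covering of degree `2`, and `τ` is the non-trivial element of its
Galois group. Over a connected `S` the last condition says `τ ≠ 𝟙`; in general it says that `τ`
is non-trivial over every non-empty open and closed part of `S`. -/
structure IsQuadraticEtale {S T : Scheme.{u}} (π : T ⟶ S) (τ : T ⟶ T) : Prop where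
  finite : IsFinite π
  etale : Etale π
  degree : ∀ s : S, π.finrank s = 2
  comp_eq : τ ≫ π = π
  isIso : IsIso τ
  nontrivial : ∀ V : S.Opens, IsClosed (V : Set S) → V ≠ ⊥ →
    (π ⁻¹ᵁ V).ι ≫ τ ≠ (π ⁻¹ᵁ V).ι

/-- The action of an `S`-endomorphism `τ` of `T` on `(π_* 𝒪_T)(U) = 𝒪_T(π⁻¹ U)`. -/
def act {S T : Scheme.{u}} (π : T ⟶ S) (τ : T ⟶ T) (h : τ ≫ π = π) (U : S.Opens) :
    Γ(T, π ⁻¹ᵁ U) →+* Γ(T, π ⁻¹ᵁ U) :=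
  (τ.appLE (π ⁻¹ᵁ U) (π ⁻¹ᵁ U) (by rw [← Scheme.Hom.comp_preimage, h])).hom

/-- Unitary type (second kind): `A` is an algebra over the degree `2` étale covering `T` of `S`,
and `σ` is an involution of `A` which on `𝒪_T` restricts to `τ`. As `π` is affine, an involution of
`A` over `S` is the same as one of `π_* A`, which is the algebra with unitary involution
over `S`. -/
def IsUnitary {S T : Scheme.{u}} (π : T ⟶ S) (τ : T ⟶ T) (h : IsQuadraticEtale π τ)
    {A : OAlgebra T} (σ : Involution (A.pushforward π)) : Prop :=
  ∀ (U : S.Opens) (x : Γ(T, π ⁻¹ᵁ U)),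
    σ.app U (algebraMap Γ(T, π ⁻¹ᵁ U) (A.sections (π ⁻¹ᵁ U)) x) =
      algebraMap Γ(T, π ⁻¹ᵁ U) (A.sections (π ⁻¹ᵁ U)) (act π τ h.comp_eq U x)

/-! ## Split models -/

/-- Isomorphism of `R`-algebras with involution. -/
def IsIsomorphic {R B C : Type u} [CommRing R] [Ring B] [Algebra R B] [Ring C] [Algebra R C]
    (σ : B →ₗ[R] B) (σ' : C →ₗ[R] C) : Prop :=
  ∃ e : B ≃ₐ[R] C, ∀ x, e (σ x) = σ' (e x)

/-- The transpose involution `tr` of `M_n(R)`. -/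
def trInvolution (n : ℕ) (R : Type u) [CommRing R] :
    Matrix (Fin n) (Fin n) R →ₗ[R] Matrix (Fin n) (Fin n) R :=
  (Matrix.transposeLinearEquiv (Fin n) (Fin n) R R).toLinearMap

/-- The block matrix `J_m = [0, I; -I, 0]`. -/
def stdJ (m : ℕ) (R : Type u) [CommRing R] : Matrix (Fin m ⊕ Fin m) (Fin m ⊕ Fin m) R :=
  Matrix.fromBlocks 0 1 (-1) 0

/-- The involution `sp : A ↦ J_m Aᵀ J_m⁻¹` of `M_{2m}(R)`. -/
def spInvolution (m : ℕ) (R : Type u) [CommRing R] :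
    Matrix (Fin m ⊕ Fin m) (Fin m ⊕ Fin m) R →ₗ[R] Matrix (Fin m ⊕ Fin m) (Fin m ⊕ Fin m) R where
  toFun X := stdJ m R * X.transpose * (stdJ m R)⁻¹
  map_add' X Y := by simp [Matrix.mul_add, Matrix.add_mul]
  map_smul' r X := by simp

/-- The exchange involution `(X, Y^op) ↦ (Y, X^op)` of `M_n(R) × M_n(R)^op`. -/
def exchangeInvolution (n : ℕ) (R : Type u) [CommRing R] :
    (Matrix (Fin n) (Fin n) R × (Matrix (Fin n) (Fin n) R)ᵐᵒᵖ) →ₗ[R]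
      (Matrix (Fin n) (Fin n) R × (Matrix (Fin n) (Fin n) R)ᵐᵒᵖ) where
  toFun X := (X.2.unop, MulOpposite.op X.1)
  map_add' _ _ := rfl
  map_smul' _ _ := rfl

end AzumayaInvolution

end

noncomputable section

namespace AzumayaInvolution

section

/-! ## Étale neighbourhoods of geometric points -/

/-! Every statement is local around a point, and étale neighbourhoods are followed by a ring map to
a field `Ω`: each extension `R → R'` comes with an extension of the geometric point `R → Ω` to `R'`.
The kernel of the last map is a prime over the given point, so the resulting charts cover `S`.

In the orthogonal and symplectic cases, the module `E` and the line bundle `L` become free after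
localization, and `σ` becomes the adjoint involution of a Gram matrix `G` on `M_k`
(`exists_hasGram`). If `G = Pᵀ M P`, conjugation by `P` turns this into the adjoint involution of
`M` (`conj_adjoint`). It remains to normalize `G` étale locally. A symmetric `G` is diagonalized by
Schur complements, and square roots of the units on the diagonal, étale because `2` is invertible,
reduce it to the identity. A skew-symmetric `G` splits off hyperbolic planes and becomes `J`.
Comparing ranks, `k² = n²`, identifies `k` with the degree.

In the unitary case, each point of `S` has a point `t` above it where `τ` acts nontrivially, so some
`b - τ b` is invertible near `t`. An étale neighbourhood `R` of `t` that splits `A` is also étale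
over `S`, since `π` is étale. Over it `𝒪_T` becomes `R × R` with `τ` the swap, and `σ` exchanges the
two factors of the algebra (`isIsomorphic_exchange`).

Charts see `A` only through `R ⊗ A(V)`, so comparing charts with different `V` requires that a
locally free algebra is quasi-coherent (`IsLocallyFreeOfFiniteRank.isBaseChange`). -/

/-- A geometric point extends to a localization away from an element that it does not kill. -/
lemma exists_lift_away {R : Type u} [CommRing R] {Ω : Type u} [Field Ω] (φ : R →+* Ω) (r : R)
    (hr : φ r ≠ 0) :
    ∃ ψ : Localization.Away r →+* Ω, ψ.comp (algebraMap R (Localization.Away r)) = φ :=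
  ⟨IsLocalization.Away.lift r (IsUnit.mk0 _ hr), IsLocalization.Away.lift_comp r _⟩

lemma etale_localizationAway {R : Type u} [CommRing R] (r : R) :
    (algebraMap R (Localization.Away r)).Etale :=
  RingHom.etale_algebraMap.mpr (Algebra.Etale.of_isLocalizationAway r)

/-- A unit has a square root in an étale neighbourhood of a geometric point if `2` is invertible. -/
lemma exists_etale_sqrt {R : Type u} [CommRing R] {Ω : Type u} [Field Ω] [IsAlgClosed Ω]
    (h2 : IsUnit (2 : R)) (φ : R →+* Ω) {a : R} (ha : IsUnit a) :
    ∃ (R' : Type u) (_ : CommRing R') (f : R →+* R') (φ' : R' →+* Ω),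
      f.Etale ∧ φ'.comp f = φ ∧ ∃ w : R', w * w = f a := by
  obtain ⟨b, hb⟩ := ha.exists_right_inv
  obtain ⟨c, hc⟩ := h2.exists_right_inv
  let P : StandardEtalePair R :=
    { f := .X ^ 2 - .C a
      monic_f := Polynomial.monic_X_pow_sub_C a two_ne_zero
      g := 1
      cond := by
        -- With `b = 1/a` and `c = 1/2` this is the identity `2X · bcX - b(X² - a) = 1`: the
        -- derivative of `X² - a` is invertible modulo `X² - a`.
        refine ⟨.C (b * c) * .X, - .C b, 1, ?_⟩
        have h1 : (Polynomial.C a * Polynomial.C b : Polynomial R) = 1 := by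
          rw [← Polynomial.C_mul, hb, Polynomial.C_1]
        have h3 : (2 * Polynomial.C c : Polynomial R) = 1 := by
          rw [← Polynomial.C_1, ← hc, Polynomial.C_mul]; rfl
        simp only [Polynomial.derivative_sub, Polynomial.derivative_X_pow, Polynomial.derivative_C,
          Polynomial.C_mul]
        push_cast
        simp only [map_ofNat]
        linear_combination (Polynomial.C b * Polynomial.X ^ 2) * h3 + h1 }
  algebraize [φ]
  obtain ⟨w, hw⟩ := IsAlgClosed.exists_pow_nat_eq (φ a) (n := 2) two_pos
  have hmap : P.HasMap w := by
    refine ⟨?_, by simp [P]⟩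
    simp [P, hw, RingHom.algebraMap_toAlgebra]
  refine ⟨P.Ring, inferInstance, algebraMap R P.Ring, (P.lift w hmap).toRingHom,
    RingHom.etale_algebraMap.mpr inferInstance, (P.lift w hmap).comp_algebraMap, P.X, ?_⟩
  have := (StandardEtalePair.hasMap_X (P := P)).1
  simp only [P, map_sub, map_pow, Polynomial.aeval_X, Polynomial.aeval_C, sub_eq_zero] at this
  rw [← pow_two, this]

/-! ## Gram matrices -/

open Matrix

variable {R : Type u} [CommRing R]

/-- Schur complement of an `ε`-symmetric matrix. -/
lemma exists_schur {α β : Type*} [Fintype α] [DecidableEq α] [Fintype β] [DecidableEq β]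
    (ε : ℤˣ) (G : Matrix (α ⊕ β) (α ⊕ β) R) (hG : Gᵀ = (ε : ℤ) • G)
    (hA : IsUnit G.toBlocks₁₁.det) :
    ∃ (U : Matrix (α ⊕ β) (α ⊕ β) R) (D : Matrix β β R), U.det = 1 ∧ Dᵀ = (ε : ℤ) • D ∧
      G = Uᵀ * fromBlocks G.toBlocks₁₁ 0 0 D * U := by
  obtain ⟨A, B, C, D, rfl⟩ : ∃ A B C D, G = fromBlocks A B C D :=
    ⟨_, _, _, _, (fromBlocks_toBlocks G).symm⟩
  simp only [toBlocks_fromBlocks₁₁] at hA ⊢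
  rw [fromBlocks_transpose, fromBlocks_smul, fromBlocks_inj] at hG
  obtain ⟨hAA, hCB, hBC, hDD⟩ := hG
  have := invertibleOfIsUnitDet A hA
  have hε : ((ε : ℤ) : ℤ) * ε = 1 := by rw [← Units.val_mul, Int.units_mul_self, Units.val_one]
  have hinv : (A⁻¹)ᵀ = (ε : ℤ) • A⁻¹ := by
    rw [transpose_nonsing_inv, hAA]
    apply inv_eq_right_inv
    rw [smul_mul_assoc, mul_smul_comm, smul_smul, hε, one_smul, mul_nonsing_inv _ hA]
  -- The two signs `ε` cancel, so the lower triangular factor of the block `LDU` decomposition is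
  -- the transpose of the upper one.
  have hL : (A⁻¹ * B)ᵀ = C * A⁻¹ := by
    rw [transpose_mul, hinv, hBC, Matrix.smul_mul, Matrix.mul_smul, smul_smul, hε, one_smul]
  refine ⟨fromBlocks 1 (A⁻¹ * B) 0 1, D - C * A⁻¹ * B, by simp, ?_, ?_⟩
  · rw [transpose_sub, hDD, Matrix.mul_assoc, transpose_mul, hL, hCB, Matrix.mul_smul, smul_sub,
      Matrix.mul_assoc]
  · have := fromBlocks_eq_of_invertible₁₁ A B C D
    rw [this]
    simp [fromBlocks_transpose, hL]

/-- An invertible matrix has an entry that does not vanish at a given geometric point. -/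
lemma exists_entry_ne_zero {ι : Type*} [Fintype ι] [DecidableEq ι] [Nonempty ι] {Ω : Type*}
    [Field Ω] (φ : R →+* Ω) (G : Matrix ι ι R) (hG : IsUnit G.det) : ∃ i j, φ (G i j) ≠ 0 := by
  by_contra! h
  have h0 : φ (G.det) = 0 := by
    rw [RingHom.map_det, show φ.mapMatrix G = 0 by ext i j; exact h i j, det_zero]
  exact (hG.map φ).ne_zero h0

/-- Polarization: if all diagonal entries vanish at the point but `G i j` does not, the form takes
the value `G i i + G j j + 2 G i j` on `e_i + e_j`, which is column `i` of the transvection. -/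
lemma exists_isUnit_det_diag_ne_zero {ι : Type*} [Fintype ι] [DecidableEq ι] [Nonempty ι]
    {Ω : Type*} [Field Ω] (h2 : IsUnit (2 : R)) (φ : R →+* Ω) (G : Matrix ι ι R)
    (hG : IsUnit G.det) (hs : Gᵀ = G) :
    ∃ (T : Matrix ι ι R) (i : ι), IsUnit T.det ∧ φ ((Tᵀ * G * T) i i) ≠ 0 := by
  by_cases h : ∃ i, φ (G i i) ≠ 0
  · obtain ⟨i, hi⟩ := h
    exact ⟨1, i, by simp, by simpa⟩
  push Not at h
  obtain ⟨i, j, hij⟩ := exists_entry_ne_zero φ G hG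
  have hne : j ≠ i := by rintro rfl; exact hij (h j)
  refine ⟨transvection j i 1, i, by simp [det_transvection_of_ne _ _ hne], ?_⟩
  have hji : G j i = G i j := congr_fun₂ hs i j
  have : ((transvection j i (1 : R))ᵀ * G * transvection j i (1 : R)) i i =
      G i i + G j j + 2 * G i j := by
    simp [transvection, transpose_add, Matrix.add_mul, Matrix.mul_add, hji]
    ring
  rw [this, map_add, map_add, h, h, map_mul, zero_add, zero_add]
  exact mul_ne_zero (h2.map φ).ne_zero hij

lemma isUnit_det_of_fromBlocks {α β : Type*} [Fintype α] [DecidableEq α] [Fintype β]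
    [DecidableEq β] {G U : Matrix (α ⊕ β) (α ⊕ β) R} {A : Matrix α α R} {D : Matrix β β R}
    (hG : IsUnit G.det) (h : G = Uᵀ * fromBlocks A 0 0 D * U) : IsUnit D.det := by
  rw [h, det_mul, det_mul, det_fromBlocks_zero₂₁] at hG
  exact isUnit_of_mul_isUnit_right (isUnit_of_mul_isUnit_right (isUnit_of_mul_isUnit_left hG))

/-- A nondegenerate symmetric matrix is étale locally congruent to the identity. -/
theorem exists_etale_transpose_mul_self {Ω : Type u} [Field Ω] [IsAlgClosed Ω] (n : ℕ) :
    ∀ (ι : Type) [Fintype ι] [DecidableEq ι], Fintype.card ι = n →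
    ∀ (R : Type u) [CommRing R], IsUnit (2 : R) → ∀ (φ : R →+* Ω) (G : Matrix ι ι R),
      IsUnit G.det → Gᵀ = G →
    ∃ (R' : Type u) (_ : CommRing R') (f : R →+* R') (φ' : R' →+* Ω),
      f.Etale ∧ φ'.comp f = φ ∧ ∃ P : Matrix ι ι R', Pᵀ * P = G.map f := by
  induction n with
  | zero =>
    intro ι _ _ hι R _ h2 φ G hG hs
    have := Fintype.card_eq_zero_iff.mp hι
    exact ⟨R, _, RingHom.id R, φ, .of_bijective Function.bijective_id, rfl, 1,
      Subsingleton.elim _ _⟩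
  | succ n ih =>
    intro ι _ _ hι R _ h2 φ G hG hs
    have : Nonempty ι := Fintype.card_pos_iff.mp (by lia)
    obtain ⟨T, i, hT, hi⟩ := exists_isUnit_det_diag_ne_zero h2 φ G hG hs
    set G₀ := Tᵀ * G * T with hG₀
    obtain ⟨Tinv, hTinv⟩ : ∃ X, T * X = 1 := ⟨T⁻¹, mul_nonsing_inv _ hT⟩
    have hGG : G = Tinvᵀ * G₀ * Tinv := by
      rw [hG₀, show Tinvᵀ * (Tᵀ * G * T) * Tinv = (T * Tinv)ᵀ * G * (T * Tinv) by
        simp only [transpose_mul, Matrix.mul_assoc], hTinv]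
      simp
    have hG₀s : G₀ᵀ = G₀ := by
      simp [hG₀, transpose_mul, hs, Matrix.mul_assoc]
    have hG₀u : IsUnit G₀.det := by
      rw [hG₀, det_mul, det_mul, det_transpose]; exact (hT.mul hG).mul hT
    obtain ⟨φ₁, hφ₁⟩ := exists_lift_away φ (G₀ i i) hi
    let g₁ := algebraMap R (Localization.Away (G₀ i i))
    -- The index `i` is split off as a block of size one, whose entry is now a unit; the Schur
    -- complement on the remaining indices goes to the induction hypothesis.
    let e := Equiv.sumCompl (· = i)
    let H := (G₀.map g₁).submatrix e e
    have hHs : Hᵀ = ((1 : ℤˣ) : ℤ) • H := by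
      simp only [H, transpose_submatrix, ← transpose_map, hG₀s, Units.val_one, one_smul]
    have ha : IsUnit (g₁ (G₀ i i)) := IsLocalization.Away.algebraMap_isUnit _
    have hHu : IsUnit H.det := by
      rw [det_submatrix_equiv_self]
      exact (RingHom.map_det g₁ G₀) ▸ hG₀u.map g₁
    have hA : H.toBlocks₁₁ = g₁ (G₀ i i) • 1 := by
      ext ⟨a, rfl⟩ ⟨b, rfl⟩
      simp [H, e, toBlocks₁₁]
    obtain ⟨U, D, hU, hDs, hHU⟩ := exists_schur 1 H hHs (by rw [hA]; simpa using ha)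
    obtain ⟨R₂, _, g₂, φ₂, hg₂, hφ₂, P, hP⟩ := ih {a // ¬ a = i}
      (by simp [Fintype.card_subtype_compl, hι]) _
      ((map_ofNat g₁ 2) ▸ h2.map g₁) φ₁ D (isUnit_det_of_fromBlocks hHu hHU) (by simpa using hDs)
    -- The root of the pivot is adjoined on top of the ring that trivializes the complement, so that
    -- `diag(w, P)` makes sense over one ring.
    obtain ⟨R₃, _, g₃, φ₃, hg₃, hφ₃, w, hw⟩ := exists_etale_sqrt
      ((map_ofNat (g₂.comp g₁) 2) ▸ h2.map (g₂.comp g₁)) φ₂ (ha.map g₂)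
    let g := g₃.comp g₂
    refine ⟨R₃, _, g.comp g₁, φ₃, ?_, ?_,
      (fromBlocks (w • 1) 0 0 (P.map g₃) * U.map g).submatrix e.symm e.symm *
        Tinv.map (g.comp g₁), ?_⟩
    · exact RingHom.Etale.stableUnderComposition _ _ (etale_localizationAway _)
        (RingHom.Etale.stableUnderComposition _ _ hg₂ hg₃)
    · rw [← hφ₁, ← hφ₂, ← hφ₃]; rfl
    · have hH : H.map g = (fromBlocks (w • 1) 0 0 (P.map g₃) * U.map g)ᵀ *
          (fromBlocks (w • 1) 0 0 (P.map g₃) * U.map g) := by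
        have hD : (P.map g₃)ᵀ * P.map g₃ = D.map g := by
          rw [← transpose_map, ← Matrix.map_mul, hP]; rfl
        rw [transpose_mul, Matrix.mul_assoc, ← Matrix.mul_assoc _ _ (U.map g),
          fromBlocks_transpose, fromBlocks_multiply]
        nth_rw 1 [hHU]
        rw [hA, Matrix.map_mul, Matrix.map_mul, fromBlocks_map, ← Matrix.mul_assoc]
        simp [hD, hw, smul_smul, transpose_map, Matrix.map_smul' , g]
        
      have hG₁ : G.map (g.comp g₁) = (Tinv.map (g.comp g₁))ᵀ *
          ((H.map g).submatrix e.symm e.symm) * Tinv.map (g.comp g₁) := by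
        have h₁ : (H.map g).submatrix e.symm e.symm = G₀.map (g.comp g₁) := by
          ext i j; simp [H]
        rw [h₁, ← transpose_map, ← Matrix.map_mul, ← Matrix.map_mul, ← hGG]
      rw [hG₁, hH]
      generalize fromBlocks (w • 1) 0 0 (P.map g₃) * U.map g = Z
      rw [← submatrix_mul_equiv Zᵀ Z _ e.symm _, ← transpose_submatrix, transpose_mul]
      simp only [Matrix.mul_assoc]

/-- The matrix of the standard symplectic form with arbitrary index type. -/
def sympJ (κ : Type*) [DecidableEq κ] (R : Type*) [CommRing R] : Matrix (κ ⊕ κ) (κ ⊕ κ) R :=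
  fromBlocks 0 1 (-1) 0

lemma sympJ_mul_sympJ (κ : Type*) [Fintype κ] [DecidableEq κ] (R : Type*) [CommRing R] :
    sympJ κ R * sympJ κ R = -1 := by
  simp [sympJ, fromBlocks_multiply, ← fromBlocks_one, fromBlocks_neg]

lemma sympJ_map (κ : Type*) [DecidableEq κ] {R R' : Type*} [CommRing R] [CommRing R']
    (f : R →+* R') : (sympJ κ R).map f = sympJ κ R' := by
  simp [sympJ, fromBlocks_map, Matrix.map_neg]

lemma isUnit_det_sympJ (κ : Type*) [Fintype κ] [DecidableEq κ] (R : Type*) [CommRing R] :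
    IsUnit (sympJ κ R).det :=
  isUnit_det_of_right_inverse (B := -sympJ κ R) (by rw [Matrix.mul_neg, sympJ_mul_sympJ, neg_neg])

/-- A nondegenerate skew-symmetric matrix is étale locally congruent to the standard one. -/
theorem exists_etale_sympJ {Ω : Type u} [Field Ω] (n : ℕ) :
    ∀ (ι : Type) [Fintype ι] [DecidableEq ι], Fintype.card ι ≤ n →
    ∀ (R : Type u) [CommRing R], IsUnit (2 : R) → ∀ (φ : R →+* Ω) (G : Matrix ι ι R),
      IsUnit G.det → Gᵀ = -G →
    ∃ (R' : Type u) (_ : CommRing R') (f : R →+* R') (φ' : R' →+* Ω),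
      f.Etale ∧ φ'.comp f = φ ∧ ∃ (κ : Type) (_ : Fintype κ) (_ : DecidableEq κ)
        (e : ι ≃ κ ⊕ κ) (P : Matrix ι ι R'),
        Pᵀ * (sympJ κ R').submatrix e e * P = G.map f := by
  induction n with
  | zero =>
    intro ι _ _ hι R _ h2 φ G hG hs
    have := Fintype.card_eq_zero_iff.mp (Nat.le_zero.mp hι)
    exact ⟨R, _, RingHom.id R, φ, .of_bijective Function.bijective_id, rfl, Empty, inferInstance,
      inferInstance, Equiv.equivOfIsEmpty _ _, 1, Subsingleton.elim _ _⟩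
  | succ n ih =>
    intro ι _ _ hι R _ h2 φ G hG hs
    rcases isEmpty_or_nonempty ι with hι0 | hι0
    · exact ih ι (by simp) R h2 φ G hG hs
    obtain ⟨i, j, hij⟩ := exists_entry_ne_zero φ G hG
    have hskew : ∀ k l, G l k = - G k l := fun k l ↦ congr_fun₂ hs k l
    -- As `2` is invertible, skew-symmetric implies alternating; hence a nonvanishing entry has `i ≠
    -- j` and spans a hyperbolic plane.
    have hdiag : ∀ k, G k k = 0 := fun k ↦ by
      have : (2 : R) * G k k = 0 := by linear_combination hskew k k
      exact (h2.mul_right_eq_zero).mp this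
    have hne : i ≠ j := by rintro rfl; exact hij (by rw [hdiag, map_zero])
    obtain ⟨φ₁, hφ₁⟩ := exists_lift_away φ (G i j) hij
    let g₁ := algebraMap R (Localization.Away (G i j))
    have ha : IsUnit (g₁ (G i j)) := IsLocalization.Away.algebraMap_isUnit _
    let β := {k // ¬ (k = i ∨ k = j)}
    let e₀ : Unit ⊕ Unit ≃ {k // k = i ∨ k = j} :=
      Equiv.ofBijective (Sum.elim (fun _ ↦ ⟨i, .inl rfl⟩) (fun _ ↦ ⟨j, .inr rfl⟩)) <| by
        constructor
        · rintro (_ | _) (_ | _) h <;> simp [hne, hne.symm] at h ⊢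
        · rintro ⟨k, rfl | rfl⟩
          exacts [⟨.inl (), rfl⟩, ⟨.inr (), rfl⟩]
    let e : (Unit ⊕ Unit) ⊕ β ≃ ι :=
      (Equiv.sumCongr e₀ (Equiv.refl β)).trans (Equiv.sumCompl fun k ↦ k = i ∨ k = j)
    let H := (G.map g₁).submatrix e e
    have hHs : Hᵀ = ((-1 : ℤˣ) : ℤ) • H := by
      ext k l
      change g₁ (G (e l) (e k)) = _
      rw [hskew (e k)]
      simp [H]
    have hHu : IsUnit H.det := by
      rw [det_submatrix_equiv_self]
      exact (RingHom.map_det g₁ G) ▸ hG.map g₁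
    -- `Q = diag(a, 1)` rescales one basis vector, taking `J` to `[0, a; -a, 0]`. No square root is
    -- needed here.
    let Q : Matrix (Unit ⊕ Unit) (Unit ⊕ Unit) (Localization.Away (G i j)) :=
      fromBlocks (g₁ (G i j) • 1) 0 0 1
    have hA : H.toBlocks₁₁ = Qᵀ * sympJ Unit _ * Q := by
      simp only [Q, sympJ, fromBlocks_transpose, fromBlocks_multiply]
      have hi : ∀ k, e (.inl (.inl k)) = i := fun _ ↦ rfl
      have hj : ∀ k, e (.inl (.inr k)) = j := fun _ ↦ rfl
      ext (k | k) (l | l) <;> simp [H, hi, hj, toBlocks₁₁, hdiag, hskew i j]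
    have hAu : IsUnit H.toBlocks₁₁.det := by
      rw [hA, det_mul, det_mul, det_transpose]
      have hQ : IsUnit Q.det := by simpa [Q] using ha
      exact (hQ.mul (isUnit_det_sympJ _ _)).mul hQ
    obtain ⟨U, D, hU, hDs, hHU⟩ := exists_schur (-1) H hHs hAu
    -- Two indices have been removed, which is why the induction bounds the cardinality instead of
    -- fixing it.
    obtain ⟨R₂, _, g, φ₂, hg, hφ₂, κ, _, _, e₂, P, hP⟩ := ih β
      (by
        have h : Fintype.card β < Fintype.card ι := Fintype.card_subtype_lt (x := i) (by simp)
        lia) _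
      ((map_ofNat g₁ 2) ▸ h2.map g₁) φ₁ D (isUnit_det_of_fromBlocks hHu hHU) (by simpa using hDs)
    -- The planes are regrouped so that all first basis vectors precede all second ones, as in the
    -- standard `J`.
    let e' : ι ≃ (Unit ⊕ κ) ⊕ (Unit ⊕ κ) := e.symm.trans
      ((Equiv.sumCongr (Equiv.refl _) e₂).trans (Equiv.sumSumSumComm Unit Unit κ κ))
    refine ⟨R₂, _, g.comp g₁, φ₂, ?_, ?_, Unit ⊕ κ, inferInstance, inferInstance, e',
      (fromBlocks (Q.map g) 0 0 P * U.map g).submatrix e.symm e.symm, ?_⟩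
    · exact RingHom.Etale.stableUnderComposition _ _ (etale_localizationAway _) hg
    · rw [← hφ₁, ← hφ₂]; rfl
    · have hJ : (sympJ (Unit ⊕ κ) R₂).submatrix e' e' =
          (fromBlocks (sympJ Unit R₂) 0 0
            ((sympJ κ R₂).submatrix e₂ e₂)).submatrix e.symm e.symm := by
        ext k l
        obtain ⟨k, rfl⟩ := e.surjective k
        obtain ⟨l, rfl⟩ := e.surjective l
        simp only [submatrix_apply, e', Equiv.trans_apply, Equiv.symm_apply_apply]
        have hl : ∀ k, Equiv.sumSumSumComm Unit Unit κ κ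
            (Equiv.sumCongr (Equiv.refl _) e₂ (.inl k)) = Sum.map .inl .inl k := by
          rintro (k | k) <;> rfl
        have hr : ∀ k, Equiv.sumSumSumComm Unit Unit κ κ
            (Equiv.sumCongr (Equiv.refl _) e₂ (.inr k)) = Sum.map .inr .inr (e₂ k) := by
          intro k
          rw [Equiv.sumCongr_apply, Sum.map_inr]
          rcases e₂ k with k | k <;> rfl
        rcases k with k | k <;> rcases l with l | l <;> simp only [hl, hr] <;>
          simp only [sympJ, fromBlocks_apply₁₁, fromBlocks_apply₁₂, fromBlocks_apply₂₁,
            fromBlocks_apply₂₂, submatrix_apply]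
        · rcases k with k | k <;> rcases l with l | l <;> simp
        · rcases k with k | k <;> rcases e₂ l with l | l <;> simp
        · rcases e₂ k with k | k <;> rcases l with l | l <;> simp
        · rcases e₂ k with k | k <;> rcases e₂ l with l | l <;> simp [Matrix.one_apply]
      have hH : H.map g = (fromBlocks (Q.map g) 0 0 P * U.map g)ᵀ *
          fromBlocks (sympJ Unit R₂) 0 0 ((sympJ κ R₂).submatrix e₂ e₂) *
          (fromBlocks (Q.map g) 0 0 P * U.map g) := by
        nth_rw 1 [hHU]
        have hA' : H.toBlocks₁₁.map g = (Q.map g)ᵀ * sympJ Unit R₂ * Q.map g := by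
          rw [hA, Matrix.map_mul, Matrix.map_mul, sympJ_map, transpose_map]
        rw [Matrix.map_mul, Matrix.map_mul, fromBlocks_map, transpose_mul,
          show ∀ X Y Z W : Matrix ((Unit ⊕ Unit) ⊕ β) ((Unit ⊕ Unit) ⊕ β) R₂,
            X * Y * Z * (W * U.map g) = X * (Y * Z * W) * U.map g by
            intros; simp only [Matrix.mul_assoc],
          fromBlocks_transpose, fromBlocks_multiply, fromBlocks_multiply, transpose_map, hA']
        simp [hP]
      have h₁ : G.map (g.comp g₁) = (H.map g).submatrix e.symm e.symm := by
        ext i j; simp [H]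
      rw [h₁, hH, hJ]
      generalize fromBlocks (Q.map g) 0 0 P * U.map g = Z
      rw [← submatrix_mul_equiv _ Z _ e.symm _, ← submatrix_mul_equiv Zᵀ _ _ e.symm _,
        transpose_submatrix]

end

section

/-! ## Localization of modules with forms -/

section Localization

variable {R : Type*} [CommRing R]

/-- `Hom` out of a finitely presented module commutes with localization. It is used for `End E` and
for the nondegeneracy map `E → Hom(E, L)`. -/
lemma isBaseChange_baseChangeHom (S : Submonoid R) (A : Type*) [CommRing A] [Algebra R A]
    [IsLocalization S A] (M N : Type*) [AddCommGroup M] [Module R M] [AddCommGroup N] [Module R N]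
    [Module.FinitePresentation R M] :
    IsBaseChange A (LinearMap.baseChangeHom R A M N) := by
  have hM := (isLocalizedModule_iff_isBaseChange S A _).mpr (TensorProduct.isBaseChange R M A)
  have hN := (isLocalizedModule_iff_isBaseChange S A _).mpr (TensorProduct.isBaseChange R N A)
  rw [← isLocalizedModule_iff_isBaseChange S A]
  convert Module.FinitePresentation.isLocalizedModule_mapExtendScalars S
    (TensorProduct.mk R A M 1) (TensorProduct.mk R A N 1) A
  ext f m
  simp only [TensorProduct.AlgebraTensorModule.curry_apply,
    TensorProduct.curry_apply, LinearMap.coe_restrictScalars]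
  exact (IsLocalizedModule.map_apply S (TensorProduct.mk R A M 1) (TensorProduct.mk R A N 1)
    f m).symm

/-- The comparison map of endomorphism algebras under base change. -/
def endBaseChangeHom (A : Type*) [CommRing A] [Algebra R A] (M : Type*) [AddCommGroup M]
    [Module R M] : A ⊗[R] Module.End R M →ₐ[A] Module.End A (A ⊗[R] M) :=
  Algebra.TensorProduct.lift (Algebra.ofId A _) (Module.End.baseChangeHom R A M)
    fun x y ↦ by rw [Algebra.ofId_apply]; exact Algebra.commute_algebraMap_left _ _

lemma endBaseChangeHom_tmul (A : Type*) [CommRing A] [Algebra R A] (M : Type*) [AddCommGroup M]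
    [Module R M] (a : A) (x : Module.End R M) :
    endBaseChangeHom A M (a ⊗ₜ x) = a • LinearMap.baseChangeHom R A M M x := by
  rw [endBaseChangeHom, Algebra.TensorProduct.lift_tmul, Algebra.ofId_apply, ← Algebra.smul_def]
  rfl

/-- Endomorphism algebras commute with localization. -/
def endBaseChange (S : Submonoid R) (A : Type*) [CommRing A] [Algebra R A]
    [IsLocalization S A] (M : Type*) [AddCommGroup M] [Module R M]
    [Module.FinitePresentation R M] :
    A ⊗[R] Module.End R M ≃ₐ[A] Module.End A (A ⊗[R] M) :=
  AlgEquiv.ofBijective (endBaseChangeHom A M) <| by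
    have h : ∀ x, endBaseChangeHom A M x = (isBaseChange_baseChangeHom S A M M).equiv x := by
      intro x
      induction x using TensorProduct.induction_on with
      | zero => simp
      | add x y hx hy => rw [map_add, map_add, hx, hy]
      | tmul a x => rw [IsBaseChange.equiv_tmul, endBaseChangeHom_tmul]
    rw [funext h]
    exact (isBaseChange_baseChangeHom S A M M).equiv.bijective

@[simp]
lemma endBaseChange_tmul_tmul (S : Submonoid R) (A : Type*) [CommRing A] [Algebra R A]
    [IsLocalization S A] (M : Type*) [AddCommGroup M] [Module R M]
    [Module.FinitePresentation R M] (a c : A) (x : Module.End R M) (y : M) :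
    endBaseChange S A M (a ⊗ₜ x) (c ⊗ₜ y) = (a * c) ⊗ₜ x y := by
  change endBaseChangeHom A M (a ⊗ₜ x) (c ⊗ₜ y) = _
  rw [endBaseChangeHom_tmul]
  rfl

lemma free_baseChange_of_algHom {A A' : Type*} [CommRing A] [Algebra R A] [CommRing A']
    [Algebra R A'] (g : A →ₐ[R] A') (M : Type*) [AddCommGroup M] [Module R M]
    [Module.Free A (A ⊗[R] M)] : Module.Free A' (A' ⊗[R] M) := by
  algebraize [g.toRingHom]
  have : IsScalarTower R A A' := .of_algebraMap_eq fun r ↦ (g.commutes r).symm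
  exact .of_equiv (TensorProduct.AlgebraTensorModule.cancelBaseChange R A A' A' M)

/-- A finite projective module is free over the local ring at `ker φ`, and by finite presentation
this freeness spreads to a basic open neighbourhood. -/
lemma exists_free_baseChange {Ω : Type*} [Field Ω] (φ : R →+* Ω) (M : Type*) [AddCommGroup M]
    [Module R M] [Module.Finite R M] [Module.Projective R M] :
    ∃ r : R, φ r ≠ 0 ∧ Module.Free (Localization.Away r) (Localization.Away r ⊗[R] M) := by
  have := Module.finitePresentation_of_projective R M
  have hp := RingHom.ker_isPrime φ
  let S := (RingHom.ker φ).primeCompl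
  have : Module.Free (Localization.AtPrime (RingHom.ker φ)) (LocalizedModule S M) :=
    Module.free_of_flat_of_isLocalRing
  obtain ⟨r, hr, hf, -⟩ := Module.FinitePresentation.exists_free_localizedModule_powers S
    (LocalizedModule.mkLinearMap S M) (Localization.AtPrime (RingHom.ker φ))
  exact ⟨r, hr, .of_equiv (LocalizedModule.equivTensorProduct _ M)⟩

end Localization

/-- The algebra with involution `(B, σ)` is isomorphic to `M_k(R)` with `X ↦ G⁻¹ Xᵀ G`. -/
def HasGram (R : Type u) [CommRing R] {B : Type u} [Ring B] [Algebra R B] (σ : B →ₗ[R] B)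
    {k : ℕ} (G : Matrix (Fin k) (Fin k) R) : Prop :=
  ∃ e : B ≃ₐ[R] Matrix (Fin k) (Fin k) R, ∀ x, (e x).transpose * G = G * e (σ x)

/-- Matrix algebras commute with base change. -/
def matrixBaseChange (R R' : Type u) [CommRing R] [CommRing R'] [Algebra R R'] (k : ℕ) :
    R' ⊗[R] Matrix (Fin k) (Fin k) R ≃ₐ[R'] Matrix (Fin k) (Fin k) R' :=
  AlgEquiv.ofRingEquiv (f := (matrixEquivTensor (Fin k) R R').symm.toRingEquiv) fun r ↦ by
    ext i j
    by_cases h : i = j <;>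
      simp [Algebra.TensorProduct.algebraMap_apply, Matrix.algebraMap_matrix_apply, h]

@[simp]
lemma matrixBaseChange_tmul {R R' : Type u} [CommRing R] [CommRing R'] [Algebra R R'] {k : ℕ}
    (a : R') (M : Matrix (Fin k) (Fin k) R) :
    matrixBaseChange R R' k (a ⊗ₜ M) = a • M.map (algebraMap R R') := by
  ext i j
  simp [matrixBaseChange]

lemma HasGram.baseChange {R : Type u} [CommRing R] {B : Type u} [Ring B] [Algebra R B]
    {σ : B →ₗ[R] B} {k : ℕ} {G : Matrix (Fin k) (Fin k) R} (h : HasGram R σ G)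
    (R' : Type u) [CommRing R'] [Algebra R R'] :
    HasGram R' (σ.baseChange R') (G.map (algebraMap R R')) := by
  obtain ⟨e, he⟩ := h
  refine ⟨(Algebra.TensorProduct.congr AlgEquiv.refl e).trans (matrixBaseChange R R' k),
    fun x ↦ ?_⟩
  induction x with
  | zero => simp
  | add x y hx hy => simp only [map_add, Matrix.transpose_add, add_mul, mul_add, hx, hy]
  | tmul a x =>
    have := congr_arg (fun M ↦ M.map (algebraMap R R')) (he x)
    simp only [Matrix.map_mul] at this
    simp [Matrix.transpose_smul, ← Matrix.transpose_map, this]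

lemma HasGram.congr {R : Type u} [CommRing R] {B B' : Type u} [Ring B] [Algebra R B]
    [Ring B'] [Algebra R B'] {σ : B →ₗ[R] B} {σ' : B' →ₗ[R] B'} {k : ℕ}
    {G : Matrix (Fin k) (Fin k) R} (h : HasGram R σ G) (f : B' ≃ₐ[R] B)
    (hf : ∀ x, f (σ' x) = σ (f x)) : HasGram R σ' G := by
  obtain ⟨e, he⟩ := h
  exact ⟨f.trans e, fun x ↦ by simp [he, hf]⟩

/-- Where `E` and `L` are both free, a trivialization of `L` makes `b` scalar valued; `G` is its
Gram matrix, and adjointness read on basis vectors is the relation in `HasGram`. -/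
theorem exists_hasGram {R : Type u} [CommRing R] {Ω : Type u} [Field Ω] (φ : R →+* Ω) (ε : ℤˣ)
    {B : Type u} [Ring B] [Algebra R B] (σ : B →ₗ[R] B) (h : IsAdjointInvolution R ε σ) :
    ∃ (r : R) (k : ℕ) (G : Matrix (Fin k) (Fin k) (Localization.Away r)),
      φ r ≠ 0 ∧ IsUnit G.det ∧ G.transpose = (ε : ℤ) • G ∧
        HasGram (Localization.Away r) (σ.baseChange (Localization.Away r)) G := by
  obtain ⟨E, L, _, _, _, _, b, e, _, _, _, hb, hsym, hadj⟩ := h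
  have := Module.finitePresentation_of_projective R E
  obtain ⟨r, hr, hEf⟩ := exists_free_baseChange φ E
  obtain ⟨s, hs, hLf⟩ := exists_free_baseChange φ L
  let A := Localization.Away (r * s)
  have hrs : φ (r * s) ≠ 0 := by simp [hr, hs]
  obtain ⟨φ', -⟩ := exists_lift_away φ (r * s) hrs
  have : Nontrivial A := φ'.domain_nontrivial
  have hrA : IsUnit (algebraMap R A r) := isUnit_of_dvd_unit (map_dvd _ (dvd_mul_right r s))
    (IsLocalization.Away.algebraMap_isUnit (r * s))
  have hsA : IsUnit (algebraMap R A s) := isUnit_of_dvd_unit (map_dvd _ (dvd_mul_left s r))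
    (IsLocalization.Away.algebraMap_isUnit (r * s))
  have hE : Module.Free A (A ⊗[R] E) := free_baseChange_of_algHom
    (IsLocalization.liftAlgHom (M := .powers r) (S := Localization.Away r)
      (f := Algebra.ofId R A) (by rintro ⟨_, n, rfl⟩; simpa using hrA.pow n)) E
  have hL : Module.Free A (A ⊗[R] L) := free_baseChange_of_algHom
    (IsLocalization.liftAlgHom (M := .powers s) (S := Localization.Away s)
      (f := Algebra.ofId R A) (by rintro ⟨_, n, rfl⟩; simpa using hsA.pow n)) L
  obtain ⟨l⟩ := Module.Invertible.free_iff_linearEquiv.mp hL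
  let v : Module.Basis (Fin (Module.finrank A (A ⊗[R] E))) A (A ⊗[R] E) :=
    Module.finBasis A _
  let Ψ : A ⊗[R] B ≃ₐ[A] Module.End A (A ⊗[R] E) :=
    (Algebra.TensorProduct.congr AlgEquiv.refl e).trans <|
      endBaseChange (.powers (r * s)) A E
  have hΨ : ∀ a x c y, Ψ (a ⊗ₜ x) (c ⊗ₜ y) = (a * c) ⊗ₜ e x y := by
    intro a x c y
    simp [Ψ]
  let b' := LinearMap.BilinMap.baseChange A b
  have hsym' : ∀ x y, b' y x = (ε : ℤ) • b' x y := by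
    intro x y
    induction x with
    | zero => simp
    | add x x' hx hx' => simp only [map_add, LinearMap.add_apply, hx, hx', smul_add]
    | tmul a x =>
      induction y with
      | zero => simp
      | add y y' hy hy' => simp only [map_add, LinearMap.add_apply, hy, hy', smul_add]
      | tmul c y =>
        simp only [b', LinearMap.BilinMap.baseChange_tmul, hsym x y, mul_comm c a]
        exact map_zsmul (TensorProduct.mk R A L (a * c)) _ _
  have hadj' : ∀ a x y, b' (Ψ a x) y = b' x (Ψ (σ.baseChange A a) y) := by
    intro a x y
    induction a with
    | zero => simp
    | add a a' ha ha' => simp only [map_add, LinearMap.add_apply, ha, ha']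
    | tmul t a =>
      induction x with
      | zero => simp
      | add x x' hx hx' => simp only [map_add, LinearMap.add_apply, hx, hx']
      | tmul c x =>
        induction y with
        | zero => simp
        | add y y' hy hy' => simp only [map_add, hy, hy']
        | tmul d y =>
          simp only [b', hΨ, LinearMap.baseChange_tmul, LinearMap.BilinMap.baseChange_tmul, hadj]
          congr 1
          ring
  -- `b'` is the base change of the isomorphism `E ≃ Hom(E, L)`, followed by the isomorphism
  -- commuting `Hom` with localization.
  have hb' : Function.Bijective b' := by
    have : b' = (isBaseChange_baseChangeHom (.powers (r * s)) A E L).equiv.toLinearMap ∘ₗ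
        b.baseChange A := by
      ext x y
      simp [b', IsBaseChange.equiv_tmul]
    rw [this]
    exact (isBaseChange_baseChangeHom (.powers (r * s)) A E L).equiv.bijective.comp
      (LinearEquiv.baseChange R A _ _ (LinearEquiv.ofBijective b hb)).bijective
  let β : A ⊗[R] E ≃ₗ[A] Module.Dual A (A ⊗[R] E) :=
    (LinearEquiv.ofBijective b' hb').trans (LinearEquiv.congrRight l)
  have hβ : ∀ x y, β x y = l (b' x y) := fun _ _ ↦ rfl
  let G : Matrix _ _ A := .of fun i j ↦ β (v i) (v j)
  refine ⟨r * s, _, G, hrs, ?_, ?_, Ψ.trans (LinearMap.toMatrixAlgEquiv v), ?_⟩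
  -- Up to transposition, `G` is the matrix of `β : E ≃ E*` in the basis `v` and its dual.
  · have := β.isUnit_det v v.dualBasis
    rw [← Matrix.det_transpose]
    rwa [show G.transpose = LinearMap.toMatrix v v.dualBasis β.toLinearMap by
      ext i j
      rw [LinearMap.toMatrix_apply, Module.Basis.dualBasis_repr]
      rfl]
  · ext i j
    change l (b' (v j) (v i)) = (ε : ℤ) • l (b' (v i) (v j))
    rw [hsym' (v i) (v j), map_zsmul]
  · intro a
    ext i j
    have hΨv : ∀ a j, Ψ a (v j) = ∑ i, (LinearMap.toMatrixAlgEquiv v) (Ψ a) i j • v i := by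
      intro a j
      simp only [LinearMap.toMatrixAlgEquiv_apply, v.sum_repr]
    have := congr_arg l (hadj' a (v i) (v j))
    rw [hΨv, hΨv] at this
    simp only [map_sum, map_smul, LinearMap.sum_apply, LinearMap.smul_apply, smul_eq_mul] at this
    simp only [Matrix.mul_apply, Matrix.transpose_apply]
    refine this.trans (Finset.sum_congr rfl fun k _ ↦ mul_comm _ _)

end

section

/-! ## Étale local forms over rings -/

open Matrix

lemma IsIsomorphic.trans {R B C D : Type u} [CommRing R] [Ring B] [Algebra R B] [Ring C]
    [Algebra R C] [Ring D] [Algebra R D] {σ : B →ₗ[R] B} {σ' : C →ₗ[R] C} {σ'' : D →ₗ[R] D}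
    (h : IsIsomorphic σ σ') (h' : IsIsomorphic σ' σ'') : IsIsomorphic σ σ'' := by
  obtain ⟨e, he⟩ := h
  obtain ⟨e', he'⟩ := h'
  exact ⟨e.trans e', fun x ↦ by simp [he, he']⟩

/-- Transitivity of base change, for not necessarily commutative algebras. -/
def cancelBaseChange (R R' R'' B : Type u) [CommRing R] [Ring B] [Algebra R B]
    [CommRing R'] [CommRing R''] [Algebra R R'] [Algebra R R''] [Algebra R' R'']
    [IsScalarTower R R' R''] : R'' ⊗[R'] (R' ⊗[R] B) ≃ₐ[R''] R'' ⊗[R] B :=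
  AlgEquiv.symm <| AlgEquiv.ofLinearEquiv
    (TensorProduct.AlgebraTensorModule.cancelBaseChange R R' R'' R'' B).symm
    (by simp [Algebra.TensorProduct.one_def]) <|
      LinearMap.map_mul_of_map_mul_tmul (fun _ _ _ _ ↦ by simp)

@[simp]
lemma cancelBaseChange_symm_tmul {R R' R'' B : Type u} [CommRing R] [Ring B] [Algebra R B]
    [CommRing R'] [CommRing R''] [Algebra R R'] [Algebra R R''] [Algebra R' R'']
    [IsScalarTower R R' R''] (a : R'') (b : B) :
    (cancelBaseChange R R' R'' B).symm (a ⊗ₜ b) = a ⊗ₜ (1 ⊗ₜ b) := rfl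

lemma isIsomorphic_baseChange_baseChange {R B : Type u} [CommRing R] [Ring B] [Algebra R B]
    (σ : B →ₗ[R] B) (R' R'' : Type u) [CommRing R'] [CommRing R''] [Algebra R R'] [Algebra R R'']
    [Algebra R' R''] [IsScalarTower R R' R''] :
    IsIsomorphic (σ.baseChange R'') ((σ.baseChange R').baseChange R'') := by
  refine ⟨(cancelBaseChange R R' R'' B).symm, fun x ↦ ?_⟩
  induction x with
  | zero => simp
  | add x y hx hy => simp only [map_add, hx, hy]
  | tmul a b => simp

lemma HasGram.of_isIsomorphic {R : Type u} [CommRing R] {B B' : Type u} [Ring B] [Algebra R B]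
    [Ring B'] [Algebra R B'] {σ : B →ₗ[R] B} {σ' : B' →ₗ[R] B'} {k : ℕ}
    {G : Matrix (Fin k) (Fin k) R} (h : HasGram R σ G) (h' : IsIsomorphic σ' σ) :
    HasGram R σ' G :=
  let ⟨f, hf⟩ := h'
  h.congr f hf

/-- Conjugation by an invertible matrix. -/
def conjAlgEquiv {R : Type u} [CommRing R] {k : ℕ} (P : Matrix (Fin k) (Fin k) R)
    (hP : IsUnit P.det) : Matrix (Fin k) (Fin k) R ≃ₐ[R] Matrix (Fin k) (Fin k) R :=
  MulSemiringAction.toAlgEquiv R _ (ConjAct.toConjAct (P.nonsingInvUnit hP))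

variable {R : Type u} [CommRing R] {B : Type u} [Ring B] [Algebra R B] {σ : B →ₗ[R] B} {k : ℕ}

/-- If `G = Pᵀ M P` then conjugation by `P` carries the adjoint involution of `G` to that
of `M`. -/
lemma conj_adjoint {G P M X Y : Matrix (Fin k) (Fin k) R} (hP : IsUnit P.det)
    (hM : IsUnit M.det) (hG : Pᵀ * M * P = G) (h : Xᵀ * G = G * Y) :
    P * Y * P⁻¹ = M⁻¹ * (P * X * P⁻¹)ᵀ * M := by
  have hPP := mul_nonsing_inv _ hP
  have hPP' := nonsing_inv_mul _ hP
  have hPT : (P⁻¹)ᵀ * Pᵀ = 1 := by rw [← transpose_mul, hPP, transpose_one]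
  have h1 : M * (P * Y * P⁻¹) = (P⁻¹)ᵀ * (G * Y) * P⁻¹ := by
    rw [← hG]
    simp only [← Matrix.mul_assoc, hPT, Matrix.one_mul]
  have h2 : (P⁻¹)ᵀ * (Xᵀ * G) * P⁻¹ = (P * X * P⁻¹)ᵀ * M := by
    rw [← hG, transpose_mul, transpose_mul]
    simp only [Matrix.mul_assoc, hPP, Matrix.mul_one]
  rw [Matrix.mul_assoc M⁻¹, ← h2, h, ← h1, ← Matrix.mul_assoc, nonsing_inv_mul _ hM, Matrix.one_mul]

lemma HasGram.isIsomorphic_tr {G : Matrix (Fin k) (Fin k) R} (h : HasGram R σ G)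
    (P : Matrix (Fin k) (Fin k) R) (hP : IsUnit P.det) (hG : Pᵀ * P = G) :
    IsIsomorphic σ (trInvolution k R) := by
  obtain ⟨e, he⟩ := h
  refine ⟨e.trans (conjAlgEquiv P hP), fun x ↦ ?_⟩
  change P * e (σ x) * P⁻¹ = (P * e x * P⁻¹)ᵀ
  simpa using conj_adjoint (M := 1) hP (by simp) (by simpa using hG) (he x)

lemma HasGram.isIsomorphic_sp {G : Matrix (Fin k) (Fin k) R} (h : HasGram R σ G) {m : ℕ}
    (f : Fin k ≃ Fin m ⊕ Fin m) (P : Matrix (Fin k) (Fin k) R) (hP : IsUnit P.det)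
    (hG : Pᵀ * (sympJ (Fin m) R).submatrix f f * P = G) :
    IsIsomorphic σ (spInvolution m R) := by
  obtain ⟨e, he⟩ := h
  refine ⟨(e.trans (conjAlgEquiv P hP)).trans (reindexAlgEquiv R R f), fun x ↦ ?_⟩
  have hJ : IsUnit ((sympJ (Fin m) R).submatrix f f).det := by
    rw [det_submatrix_equiv_self]; exact isUnit_det_sympJ _ _
  have := congr_arg (reindexAlgEquiv R R f) (conj_adjoint hP hJ hG (he x))
  change reindexAlgEquiv R R f (P * e (σ x) * P⁻¹) =
    sympJ (Fin m) R * (reindexAlgEquiv R R f (P * e x * P⁻¹))ᵀ * (sympJ (Fin m) R)⁻¹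
  -- `conj_adjoint` yields `J⁻¹ Zᵀ J`, the model is `J Zᵀ J⁻¹`; they agree because `J⁻¹ = -J`.
  have hinv : (sympJ (Fin m) R)⁻¹ = - sympJ (Fin m) R :=
    inv_eq_right_inv (by rw [Matrix.mul_neg, sympJ_mul_sympJ, neg_neg])
  rw [this, map_mul, map_mul, hinv]
  have h1 : reindexAlgEquiv R R f ((sympJ (Fin m) R).submatrix f f) = sympJ (Fin m) R := by
    ext i j; simp
  have h2 : reindexAlgEquiv R R f ((sympJ (Fin m) R).submatrix f f)⁻¹ = - sympJ (Fin m) R := by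
    rw [← hinv, inv_submatrix_equiv]
    ext i j; simp
  rw [h1, h2]
  simp only [Matrix.neg_mul, Matrix.mul_neg]
  rfl

variable {Ω : Type u} [Field Ω] 

/-- The size `k` is left free here; `eq_degree` later equates it with the degree. -/
theorem exists_etale_isIsomorphic_tr [IsAlgClosed Ω] (h2 : IsUnit (2 : R)) (φ : R →+* Ω)
    (h : IsAdjointInvolution R 1 σ) :
    ∃ (R' : Type u) (_ : CommRing R') (_ : Algebra R R') (φ' : R' →+* Ω) (k : ℕ),
      Algebra.Etale R R' ∧ φ'.comp (algebraMap R R') = φ ∧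
        IsIsomorphic (σ.baseChange R') (trInvolution k R') := by
  obtain ⟨r, k, G, hr, hGu, hGs, hG⟩ := exists_hasGram φ 1 σ h
  obtain ⟨φ₁, hφ₁⟩ := exists_lift_away φ r hr
  obtain ⟨R', _, f, φ', hf, hφ', P, hP⟩ := exists_etale_transpose_mul_self k (Fin k) (by simp)
    (Localization.Away r)
    ((map_ofNat (algebraMap R (Localization.Away r)) 2) ▸ h2.map _) φ₁ G hGu (by simpa using hGs)
  let _ : Algebra (Localization.Away r) R' := f.toAlgebra
  let _ : Algebra R R' := (f.comp (algebraMap R (Localization.Away r))).toAlgebra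
  have : IsScalarTower R (Localization.Away r) R' := .of_algebraMap_eq fun _ ↦ rfl
  have : Algebra.Etale (Localization.Away r) R' := RingHom.etale_algebraMap.mp hf
  have : Algebra.Etale R (Localization.Away r) := .of_isLocalizationAway r
  refine ⟨R', _, inferInstance, φ', k, .comp R (Localization.Away r) R', ?_, ?_⟩
  · rw [← hφ₁, ← hφ']; rfl
  · refine ((hG.baseChange R').of_isIsomorphic
      (isIsomorphic_baseChange_baseChange σ _ R')).isIsomorphic_tr P ?_ hP
    have := hGu.map f
    rw [RingHom.map_det, RingHom.mapMatrix_apply, ← hP, det_mul] at this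
    exact isUnit_of_mul_isUnit_right this

theorem exists_etale_isIsomorphic_sp (h2 : IsUnit (2 : R)) (φ : R →+* Ω)
    (h : IsAdjointInvolution R (-1) σ) :
    ∃ (R' : Type u) (_ : CommRing R') (_ : Algebra R R') (φ' : R' →+* Ω) (m : ℕ),
      Algebra.Etale R R' ∧ φ'.comp (algebraMap R R') = φ ∧
        IsIsomorphic (σ.baseChange R') (spInvolution m R') := by
  obtain ⟨r, k, G, hr, hGu, hGs, hG⟩ := exists_hasGram φ (-1) σ h
  obtain ⟨φ₁, hφ₁⟩ := exists_lift_away φ r hr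
  obtain ⟨R', _, f, φ', hf, hφ', κ, _, _, e, P, hP⟩ := exists_etale_sympJ k (Fin k) (by simp)
    (Localization.Away r)
    ((map_ofNat (algebraMap R (Localization.Away r)) 2) ▸ h2.map _) φ₁ G hGu (by simpa using hGs)
  let _ : Algebra (Localization.Away r) R' := f.toAlgebra
  let _ : Algebra R R' := (f.comp (algebraMap R (Localization.Away r))).toAlgebra
  have : IsScalarTower R (Localization.Away r) R' := .of_algebraMap_eq fun _ ↦ rfl
  have : Algebra.Etale (Localization.Away r) R' := RingHom.etale_algebraMap.mp hf
  have : Algebra.Etale R (Localization.Away r) := .of_isLocalizationAway r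
  refine ⟨R', _, inferInstance, φ', Fintype.card κ, .comp R (Localization.Away r) R', ?_, ?_⟩
  · rw [← hφ₁, ← hφ']; rfl
  · let c := Fintype.equivFin κ
    refine ((hG.baseChange R').of_isIsomorphic
      (isIsomorphic_baseChange_baseChange σ _ R')).isIsomorphic_sp
      (e.trans (Equiv.sumCongr c c)) P ?_ ?_
    · have := hGu.map f
      rw [RingHom.map_det, RingHom.mapMatrix_apply, ← hP, det_mul] at this
      exact isUnit_of_mul_isUnit_right this
    · rw [show (algebraMap (Localization.Away r) R') = f from rfl, ← hP]
      congr 2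
      ext i j
      simp only [submatrix_apply, Equiv.trans_apply, Equiv.sumCongr_apply, sympJ]
      rcases e i with a | a <;> rcases e j with b | b <;> simp [Matrix.one_apply]

end

section

/-! ## Quasi-coherence of locally free algebras -/

namespace OAlgebra

variable {S : Scheme.{u}} (A : OAlgebra S)

/-- Restriction of functions. -/
abbrev resΓ (S : Scheme.{u}) {V U : S.Opens} (h : V ≤ U) : Γ(S, U) →+* Γ(S, V) :=
  (S.presheaf.map (homOfLE h).op).hom

lemma res_res {W V U : S.Opens} (h : W ≤ V) (h' : V ≤ U) (a : A.sections U) :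
    A.res h (A.res h' a) = A.res (h.trans h') a := by
  have := A.sheaf.obj.map_comp (homOfLE h').op (homOfLE h).op
  exact (congr_arg (fun f ↦ f.hom a) this).symm

lemma resΓ_resΓ {W V U : S.Opens} (h : W ≤ V) (h' : V ≤ U) (a : Γ(S, U)) :
    resΓ S h (resΓ S h' a) = resΓ S (h.trans h') a := by
  have := S.presheaf.map_comp (homOfLE h').op (homOfLE h).op
  exact (congr_arg (fun f ↦ f.hom a) this).symm

lemma res_algebraMap {V U : S.Opens} (h : V ≤ U) (r : Γ(S, U)) :
    A.res h (algebraMap _ (A.sections U) r) = algebraMap _ (A.sections V) (resΓ S h r) := by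
  have := A.unit.hom.naturality (homOfLE h).op
  exact (congr_arg (fun f ↦ f.hom r) this).symm

lemma res_smul {V U : S.Opens} (h : V ≤ U) (r : Γ(S, U)) (a : A.sections U) :
    A.res h (r • a) = resΓ S h r • A.res h a := by
  rw [Algebra.smul_def, Algebra.smul_def, map_mul, res_algebraMap]

lemma eq_of_res_eq {ι : Type u} {U : S.Opens} (W : ι → S.Opens) (hW : ∀ i, W i ≤ U)
    (hU : U ≤ iSup W) {a b : A.sections U} (h : ∀ i, A.res (hW i) a = A.res (hW i) b) : a = b :=
  A.sheaf.eq_of_locally_eq' W U (fun i ↦ homOfLE (hW i)) hU a b h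

lemma exists_glue {ι : Type u} {U : S.Opens} (W : ι → S.Opens) (hW : ∀ i, W i ≤ U)
    (hU : U ≤ iSup W) (a : ∀ i, A.sections (W i))
    (h : ∀ i j, A.res (inf_le_left : W i ⊓ W j ≤ W i) (a i) =
      A.res (inf_le_right : W i ⊓ W j ≤ W j) (a j)) :
    ∃ b : A.sections U, ∀ i, A.res (hW i) b = a i :=
  (A.sheaf.existsUnique_gluing' W U (fun i ↦ homOfLE (hW i)) hU a h).exists

/-- `A` is free of rank `r` on `U`, compatibly with restriction. -/
def IsFreeOn (U : S.Opens) (r : ℕ) : Prop :=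
  ∃ e : Fin r → A.sections U, ∀ (V : S.Opens) (h : V ≤ U),
      LinearIndependent Γ(S, V) (fun i => A.res h (e i)) ∧
      Submodule.span Γ(S, V) (Set.range fun i => A.res h (e i)) = ⊤

variable {A}

lemma IsFreeOn.mono {U V : S.Opens} {r : ℕ} (h : A.IsFreeOn U r) (hV : V ≤ U) :
    A.IsFreeOn V r := by
  obtain ⟨e, he⟩ := h
  refine ⟨fun i ↦ A.res hV (e i), fun W hW ↦ ?_⟩
  simpa only [res_res] using he W (hW.trans hV)

/-- In coordinates this is the corresponding fact for functions on an affine open; the sum of the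
exponents serves all coordinates at once. -/
lemma IsFreeOn.exists_smul_eq_zero {U D : S.Opens} {r : ℕ} (h : A.IsFreeOn U r)
    (hU : IsAffineOpen U) (f : Γ(S, U)) (hDU : D ≤ U) (hD : D = S.basicOpen f) (a : A.sections U)
    (ha : A.res hDU a = 0) : ∃ n : ℕ, f ^ n • a = 0 := by
  obtain ⟨e, he⟩ := h
  let _ : Algebra Γ(S, U) Γ(S, D) := (resΓ S hDU).toAlgebra
  have : IsLocalization.Away f Γ(S, D) :=
    hU.isLocalization_of_eq_basicOpen f (homOfLE hDU) hD
  obtain ⟨hli, hsp⟩ := he U le_rfl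
  obtain ⟨c, rfl⟩ := (Submodule.mem_span_range_iff_exists_fun _).mp
    (hsp ▸ Submodule.mem_top : a ∈ _)
  have h0 : ∀ i, resΓ S hDU (c i) = 0 := by
    have := Fintype.linearIndependent_iff.mp (he D hDU).1 (fun i ↦ resΓ S hDU (c i))
    apply this
    simpa [map_sum, res_smul, res_res] using ha
  have h1 : ∀ i, ∃ n : ℕ, f ^ n * c i = 0 := fun i ↦ by
    obtain ⟨⟨_, n, rfl⟩, hn⟩ := (IsLocalization.map_eq_zero_iff (.powers f) Γ(S, D) (c i)).mp (h0 i)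
    exact ⟨n, hn⟩
  choose n hn using h1
  refine ⟨∑ i, n i, ?_⟩
  rw [Finset.smul_sum]
  refine Finset.sum_eq_zero fun i _ ↦ ?_
  rw [smul_smul, ← Finset.sum_erase_add _ _ (Finset.mem_univ i), pow_add, mul_assoc, hn, mul_zero,
    zero_smul]

lemma IsFreeOn.exists_res_eq_smul {U D : S.Opens} {r : ℕ} (h : A.IsFreeOn U r)
    (hU : IsAffineOpen U) (f : Γ(S, U)) (hDU : D ≤ U) (hD : D = S.basicOpen f) (b : A.sections D) :
    ∃ (n : ℕ) (a : A.sections U), A.res hDU a = resΓ S hDU f ^ n • b := by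
  obtain ⟨e, he⟩ := h
  let _ : Algebra Γ(S, U) Γ(S, D) := (resΓ S hDU).toAlgebra
  have : IsLocalization.Away f Γ(S, D) :=
    hU.isLocalization_of_eq_basicOpen f (homOfLE hDU) hD
  obtain ⟨c, rfl⟩ := (Submodule.mem_span_range_iff_exists_fun _).mp
    ((he D hDU).2 ▸ Submodule.mem_top : b ∈ _)
  obtain ⟨⟨_, n, rfl⟩, hn⟩ := IsLocalization.exist_integer_multiples_of_finite (.powers f) c
  choose d hd using hn
  refine ⟨n, ∑ i, d i • e i, ?_⟩
  rw [map_sum, Finset.smul_sum]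
  refine Finset.sum_congr rfl fun i _ ↦ ?_
  rw [res_smul, smul_smul]
  congr 1
  refine (hd i).trans ?_
  rw [Algebra.smul_def, map_pow]
  rfl

lemma IsLocallyFreeOfFiniteRank.exists_cover (hA : A.IsLocallyFreeOfFiniteRank) {V : S.Opens}
    (hV : IsAffineOpen V) : ∃ (ι : Type u) (_ : Finite ι) (g : ι → Γ(S, V)) (r : ι → ℕ),
      V ≤ (⨆ i, S.basicOpen (g i)) ∧ ∀ i, A.IsFreeOn (S.basicOpen (g i)) (r i) := by
  have h : ∀ s : V, ∃ (g : Γ(S, V)) (r : ℕ), s.1 ∈ S.basicOpen g ∧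
      A.IsFreeOn (S.basicOpen g) r := by
    intro s
    obtain ⟨U, hsU, r, e, he⟩ := hA s.1
    obtain ⟨g, hg, hsg⟩ := hV.exists_basicOpen_le (V := U) ⟨s.1, hsU⟩ s.2
    exact ⟨g, r, hsg, IsFreeOn.mono ⟨e, he⟩ hg⟩
  choose g r hg hr using h
  obtain ⟨t, ht⟩ := hV.isCompact.elim_finite_subcover
    (fun s : V ↦ (S.basicOpen (g s) : Set S)) (fun s ↦ (S.basicOpen (g s)).2)
    (fun s hs ↦ Set.mem_iUnion.mpr ⟨⟨s, hs⟩, hg ⟨s, hs⟩⟩)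
  refine ⟨t, inferInstance, fun i ↦ g i, fun i ↦ r i, fun s hs ↦ ?_, fun i ↦ hr i⟩
  obtain ⟨i, hi, his⟩ := Set.mem_iUnion₂.mp (ht hs)
  exact TopologicalSpace.Opens.mem_iSup.mpr ⟨⟨i, hi⟩, his⟩

lemma pow_smul_eq_zero_of_le {R M : Type*} [CommRing R] [AddCommGroup M] [Module R M] {f : R}
    {a : M} {n m : ℕ} (h : f ^ n • a = 0) (hnm : n ≤ m) : f ^ m • a = 0 := by
  obtain ⟨k, rfl⟩ := Nat.exists_eq_add_of_le hnm
  rw [add_comm, pow_add, mul_smul, h, smul_zero]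

lemma exists_le_of_finite {ι : Type*} [Finite ι] (n : ι → ℕ) : ∃ N, ∀ i, n i ≤ N := by
  obtain ⟨N, hN⟩ := Set.finite_range n |>.bddAbove
  exact ⟨N, fun i ↦ hN ⟨i, rfl⟩⟩

variable (hA : A.IsLocallyFreeOfFiniteRank) {V D : S.Opens} (hV : IsAffineOpen V) (f : Γ(S, V))
  (hDV : D ≤ V) (hD : D = S.basicOpen f)

include hA hV hD

lemma IsLocallyFreeOfFiniteRank.exists_smul_eq_zero (a : A.sections V) (ha : A.res hDV a = 0) :
    ∃ n : ℕ, f ^ n • a = 0 := by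
  obtain ⟨ι, _, g, r, hg, hr⟩ := hA.exists_cover hV
  have hle : ∀ i, S.basicOpen (g i) ≤ V := fun i ↦ S.basicOpen_le _
  have h : ∀ i, ∃ n : ℕ, resΓ S (hle i) f ^ n • A.res (hle i) a = 0 := fun i ↦ by
    refine (hr i).exists_smul_eq_zero (hV.basicOpen _) (D := S.basicOpen (g i) ⊓ D) _ inf_le_left
      (by rw [hD]; exact (S.basicOpen_res f (homOfLE (hle i)).op).symm) _ ?_
    rw [res_res, ← res_res _ inf_le_right hDV, ha, map_zero]
  choose n hn using h
  obtain ⟨N, hN⟩ := exists_le_of_finite n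
  refine ⟨N, A.eq_of_res_eq _ hle hg fun i ↦ ?_⟩
  rw [res_smul, map_pow, map_zero, pow_smul_eq_zero_of_le (hn i) (hN i)]

lemma IsLocallyFreeOfFiniteRank.exists_res_eq_smul (b : A.sections D) :
    ∃ (n : ℕ) (a : A.sections V), A.res hDV a = resΓ S hDV f ^ n • b := by
  obtain ⟨ι, _, g, r, hg, hr⟩ := hA.exists_cover hV
  have hle : ∀ i, S.basicOpen (g i) ≤ V := fun i ↦ S.basicOpen_le _
  have h : ∀ i, ∃ (n : ℕ) (a : A.sections (S.basicOpen (g i))),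
      A.res (inf_le_left : S.basicOpen (g i) ⊓ D ≤ _) a =
        resΓ S (inf_le_left.trans (hle i)) f ^ n • A.res inf_le_right b := fun i ↦ by
    obtain ⟨n, a, ha⟩ := (hr i).exists_res_eq_smul (hV.basicOpen _) (D := S.basicOpen (g i) ⊓ D)
      (resΓ S (hle i) f) inf_le_left
      (by rw [hD]; exact (S.basicOpen_res f (homOfLE (hle i)).op).symm) (A.res inf_le_right b)
    exact ⟨n, a, by rw [ha, resΓ_resΓ]⟩
  choose n a ha using h
  obtain ⟨N, hN⟩ := exists_le_of_finite n
  have h : ∀ i, ∃ (a : A.sections (S.basicOpen (g i))),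
      A.res (inf_le_left : S.basicOpen (g i) ⊓ D ≤ _) a =
        resΓ S (inf_le_left.trans (hle i)) f ^ N • A.res inf_le_right b := fun i ↦ by
    refine ⟨resΓ S (hle i) f ^ (N - n i) • a i, ?_⟩
    rw [res_smul, ha, map_pow, resΓ_resΓ, smul_smul, ← pow_add, Nat.sub_add_cancel (hN i)]
  choose a ha using h
  have hle' : ∀ i j, S.basicOpen (g i) ⊓ S.basicOpen (g j) ≤ V := fun i j ↦
    inf_le_left.trans (hle i)
  -- On overlaps the chosen lifts agree only after restriction to `D`, so their differences are
  -- killed by powers of `f`; one further common factor `f ^ M` makes them glue.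
  have h : ∀ p : ι × ι, ∃ m : ℕ, resΓ S (hle' p.1 p.2) f ^ m •
      (A.res inf_le_left (a p.1) - A.res inf_le_right (a p.2)) = 0 := by
    rintro ⟨i, j⟩
    refine ((hr i).mono inf_le_left).exists_smul_eq_zero
      (D := S.basicOpen (g i) ⊓ S.basicOpen (g j) ⊓ D) ?_ _ inf_le_left ?_ _ ?_
    · rw [← S.basicOpen_mul]; exact hV.basicOpen _
    · rw [hD]; exact (S.basicOpen_res f (homOfLE (hle' i j)).op).symm
    · rw [map_sub, res_res, res_res, sub_eq_zero,
        ← A.res_res (V := S.basicOpen (g i) ⊓ D) (le_inf (inf_le_left.trans inf_le_left)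
          inf_le_right) inf_le_left,
        ← A.res_res (V := S.basicOpen (g j) ⊓ D) (le_inf (inf_le_left.trans inf_le_right)
          inf_le_right) inf_le_left, ha, ha, res_smul, res_smul, map_pow, map_pow, resΓ_resΓ,
        resΓ_resΓ, res_res, res_res]
  choose m hm using h
  obtain ⟨M, hM⟩ := exists_le_of_finite m
  obtain ⟨c, hc⟩ := A.exists_glue _ hle hg (fun i ↦ resΓ S (hle i) f ^ M • a i) (by
    intro i j
    rw [← sub_eq_zero, res_smul, res_smul, map_pow, map_pow, resΓ_resΓ, resΓ_resΓ, ← smul_sub]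
    exact pow_smul_eq_zero_of_le (hm (i, j)) (hM (i, j)))
  refine ⟨M + N, c, A.eq_of_res_eq (fun i ↦ S.basicOpen (g i) ⊓ D) (fun i ↦ inf_le_right)
    ?_ fun i ↦ ?_⟩
  · rw [← iSup_inf_eq]
    exact le_inf (hDV.trans hg) le_rfl
  · rw [res_res, ← A.res_res inf_le_left (hle i), hc, res_smul, ha, res_smul, smul_smul]
    simp only [map_mul, map_pow, resΓ_resΓ, pow_add]

/-- A locally free algebra is quasi-coherent: sections over a basic open subset are
obtained by localization. -/
theorem IsLocallyFreeOfFiniteRank.isBaseChange [Algebra Γ(S, V) Γ(S, D)]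
    [Module Γ(S, V) (A.sections D)] [IsScalarTower Γ(S, V) Γ(S, D) (A.sections D)]
    (halg : algebraMap Γ(S, V) Γ(S, D) = resΓ S hDV)
    (ρ : A.sections V →ₗ[Γ(S, V)] A.sections D) (hρ : ∀ a, ρ a = A.res hDV a) :
    IsBaseChange Γ(S, D) ρ := by
  have : IsLocalization.Away f Γ(S, D) := by
    have := hV.isLocalization_of_eq_basicOpen f (homOfLE hDV) hD
    convert this
    exact Algebra.algebra_ext _ _ fun r ↦ congr($halg r)
  rw [← isLocalizedModule_iff_isBaseChange (.powers f)]
  have hsmul : ∀ (r : Γ(S, V)) (b : A.sections D), r • b = resΓ S hDV r • b := fun r b ↦ by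
    rw [← algebraMap_smul Γ(S, D) r b, halg]
  refine ⟨?_, fun b ↦ ?_, fun {a b} h ↦ ?_⟩
  · intro s
    rw [← (Algebra.lsmul Γ(S, V) (A := Γ(S, D)) Γ(S, V) (A.sections D)).commutes]
    exact (IsLocalization.map_units Γ(S, D) s).map _
  · obtain ⟨n, a, ha⟩ := hA.exists_res_eq_smul hV f hDV hD b
    refine ⟨(a, ⟨_, n, rfl⟩), ?_⟩
    rw [hρ, ha, Submonoid.smul_def, hsmul, map_pow]
  · obtain ⟨n, hn⟩ := hA.exists_smul_eq_zero hV f hDV hD (a - b)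
      (by rw [map_sub, ← hρ, ← hρ, h, sub_self])
    exact ⟨⟨_, n, rfl⟩, by rwa [smul_sub, sub_eq_zero] at hn⟩

end OAlgebra

end

/-! ### Ranks and refinement of charts; the orthogonal and symplectic cases. -/

section

namespace OAlgebra

variable {S : Scheme.{u}} {A : OAlgebra S}

/-- A locally free algebra is quasi-coherent, as an isomorphism of algebras. -/
theorem IsLocallyFreeOfFiniteRank.exists_restrictEquiv (hA : A.IsLocallyFreeOfFiniteRank)
    {V D : S.Opens} (hV : IsAffineOpen V) (f : Γ(S, V)) (hDV : D ≤ V) (hD : D = S.basicOpen f)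
    [Algebra Γ(S, V) Γ(S, D)] (halg : algebraMap Γ(S, V) Γ(S, D) = resΓ S hDV) :
    ∃ e : Γ(S, D) ⊗[Γ(S, V)] A.sections V ≃ₐ[Γ(S, D)] A.sections D,
      ∀ x a, e (x ⊗ₜ a) = x • A.res hDV a := by
  let _ : Algebra Γ(S, V) (A.sections D) :=
    ((algebraMap Γ(S, D) (A.sections D)).comp (resΓ S hDV)).toAlgebra'
      fun r a ↦ Algebra.commutes (resΓ S hDV r) a
  have : IsScalarTower Γ(S, V) Γ(S, D) (A.sections D) :=
    .of_algebraMap_eq fun r ↦ by rw [halg]; rfl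
  let ρ : A.sections V →ₐ[Γ(S, V)] A.sections D :=
    { A.res hDV with commutes' := fun r ↦ A.res_algebraMap hDV r }
  have h := hA.isBaseChange hV f hDV hD halg ρ.toLinearMap fun _ ↦ rfl
  have hρ : ∀ x : Γ(S, D) ⊗[Γ(S, V)] A.sections V,
      Algebra.TensorProduct.lift (Algebra.ofId Γ(S, D) (A.sections D)) ρ
        (fun x y ↦ by rw [Algebra.ofId_apply]; exact Algebra.commute_algebraMap_left _ _) x =
          h.equiv x := by
    intro x
    induction x with
    | zero => simp
    | add x y hx hy => rw [map_add, map_add, hx, hy]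
    | tmul a x =>
      rw [IsBaseChange.equiv_tmul, Algebra.TensorProduct.lift_tmul, Algebra.ofId_apply,
        ← Algebra.smul_def]
      rfl
  refine ⟨AlgEquiv.ofBijective _ (by rw [funext hρ]; exact h.equiv.bijective), fun x a ↦ ?_⟩
  exact (hρ _).trans (IsBaseChange.equiv_tmul _ _ _)

/-- On a basic open `D` of `V` inside `U`, `A(D)` is the base change of `A(V)` and also has a basis
of `r` elements. The rank is thus attached to the point, independently of the affine open. -/
lemma IsAzumaya.rankAtStalk_eq (hA : A.IsAzumaya) {U V : S.Opens} {r : ℕ} (h : A.IsFreeOn U r)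
    (hV : IsAffineOpen V) (p : PrimeSpectrum Γ(S, V)) (hp : hV.fromSpec p ∈ U) :
    Module.rankAtStalk (A.sections V) p = r := by
  have hpV : hV.fromSpec p ∈ V := by
    rw [← SetLike.mem_coe, ← hV.range_fromSpec]; exact ⟨p, rfl⟩
  obtain ⟨f, hfU, hpf⟩ := hV.exists_basicOpen_le (V := U) ⟨hV.fromSpec p, hp⟩ hpV
  let D := S.basicOpen f
  have hDV : D ≤ V := S.basicOpen_le f
  have hDa : IsAffineOpen D := hV.basicOpen f
  let _ : Algebra Γ(S, V) Γ(S, D) := (resΓ S hDV).toAlgebra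
  obtain ⟨e, -⟩ := hA.locallyFree.exists_restrictEquiv hV f hDV rfl rfl
  have := hA.azumaya V hV
  let q : PrimeSpectrum Γ(S, D) := hDa.primeIdealOf ⟨_, hpf⟩
  have hq : q.comap (algebraMap Γ(S, V) Γ(S, D)) = p := by
    apply hV.fromSpec.isOpenEmbedding.injective
    have h1 := hDa.fromSpec_primeIdealOf ⟨_, hpf⟩
    refine Eq.trans ?_ h1
    rw [← hV.map_fromSpec hDa (homOfLE hDV).op]
    rfl
  rw [← hq, ← Module.rankAtStalk_baseChange, Module.rankAtStalk_eq_of_equiv e.toLinearEquiv]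
  obtain ⟨b, hb⟩ := h.mono hfU
  obtain ⟨hli, hsp⟩ := hb D le_rfl
  let b' := Module.Basis.mk hli hsp.ge
  have : Module.Free Γ(S, D) (A.sections D) := .of_basis b'
  have : Module.Finite Γ(S, D) (A.sections D) := .of_basis b'
  have : Nontrivial Γ(S, D) := q.nontrivial
  rw [Module.rankAtStalk_eq_finrank_of_free, Module.finrank_eq_card_basis b']
  simp

end OAlgebra

variable {S : Scheme.{u}}

/-- The étale chart on the same affine open subset with another étale algebra. -/
abbrev EtaleChart.refine (c : EtaleChart S) (R' : Type u) [CommRing R'] [Algebra Γ(S, c.V) R']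
    [Algebra.Etale Γ(S, c.V) R'] : EtaleChart S where
  V := c.V
  isAffineOpen := c.isAffineOpen
  R := R'

lemma EtaleChart.map_apply (c : EtaleChart S) (q : PrimeSpectrum c.R) :
    c.map q = c.isAffineOpen.fromSpec (q.comap (algebraMap Γ(S, c.V) c.R)) :=
  Scheme.Hom.comp_apply _ _ (show ↥(Spec (.of c.R)) from q)

lemma exists_geometric_point {R : Type u} [CommRing R] (q : PrimeSpectrum R) :
    ∃ (Ω : Type u) (_ : Field Ω) (_ : IsAlgClosed Ω) (φ : R →+* Ω), RingHom.ker φ = q.asIdeal := by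
  refine ⟨AlgebraicClosure q.asIdeal.ResidueField, inferInstance, inferInstance,
    (algebraMap q.asIdeal.ResidueField
      (AlgebraicClosure q.asIdeal.ResidueField)).comp (algebraMap R _), ?_⟩
  rw [RingHom.ker_comp_of_injective _ (RingHom.injective _)]
  exact Ideal.ker_algebraMap_residueField _

lemma EtaleChart.map_mem_range_refine (c : EtaleChart S) (R' : Type u) [CommRing R']
    [Algebra c.R R'] [Algebra Γ(S, c.V) R'] [IsScalarTower Γ(S, c.V) c.R R']
    [Algebra.Etale Γ(S, c.V) R'] {Ω : Type u} [Field Ω] {φ : c.R →+* Ω}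
    {q : PrimeSpectrum c.R} (hφ : RingHom.ker φ = q.asIdeal) (φ' : R' →+* Ω)
    (h : φ'.comp (algebraMap c.R R') = φ) : c.map q ∈ Set.range (c.refine R').map := by
  let q' : PrimeSpectrum R' := ⟨RingHom.ker φ', RingHom.ker_isPrime φ'⟩
  have hq : q'.comap (algebraMap c.R R') = q := by
    ext1
    rw [← hφ, ← h]
    rfl
  refine ⟨q', ((c.refine R').map_apply q').trans ?_⟩
  rw [← hq]
  refine Eq.trans ?_ (c.map_apply _).symm
  rw [← PrimeSpectrum.comap_comp_apply, ← IsScalarTower.algebraMap_eq]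

/-- The degree of an Azumaya algebra can be computed on any chart that splits it. -/
lemma OAlgebra.IsAzumayaOfDegree.eq_degree {A : OAlgebra S} {n k : ℕ} (hA : A.IsAzumayaOfDegree n)
    (c : EtaleChart S) [Nonempty (PrimeSpectrum c.R)]
    (h : Nonempty (A.pull c ≃ₗ[c.R] Matrix (Fin k) (Fin k) c.R)) : k = n := by
  obtain ⟨q⟩ := ‹Nonempty (PrimeSpectrum c.R)›
  obtain ⟨c', ⟨q', hq'⟩, ⟨e'⟩⟩ := hA.degree (c.map q)
  obtain ⟨e⟩ := h
  obtain ⟨U, hU, r, b, hb⟩ := hA.locallyFree (c.map q)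
  -- Applied to the given chart and to one from the definition of the degree, through the same
  -- point, this gives `k * k = r = n * n`.
  have key : ∀ (c : EtaleChart S) (q : PrimeSpectrum c.R) (k : ℕ), c.map q ∈ U →
      (A.pull c ≃ₗ[c.R] Matrix (Fin k) (Fin k) c.R) → k * k = r := by
    intro c q k hq e
    have h1 := hA.toIsAzumaya.rankAtStalk_eq ⟨b, hb⟩ c.isAffineOpen
      (q.comap (algebraMap Γ(S, c.V) c.R)) (by rwa [← EtaleChart.map_apply])
    have := hA.azumaya c.V c.isAffineOpen
    have : Nontrivial c.R := q.nontrivial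
    rw [← Module.rankAtStalk_baseChange, Module.rankAtStalk_eq_of_equiv e,
      Module.rankAtStalk_eq_finrank_of_free] at h1
    simpa [Module.finrank_matrix] using h1
  have h1 := key c q k hU e
  have h2 := key c' q' n (hq'.symm ▸ hU) e'.toLinearEquiv
  exact Nat.mul_self_inj.mp (h1.trans h2.symm)

lemma EtaleChart.isUnit_two (h2 : IsUnit (2 : Γ(S, ⊤))) (c : EtaleChart S) : IsUnit (2 : c.R) := by
  have := h2.map ((algebraMap Γ(S, c.V) c.R).comp (OAlgebra.resΓ S le_top))
  rwa [map_ofNat] at this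

theorem etaleLocally_tr (h2 : IsUnit (2 : Γ(S, ⊤))) {n : ℕ} (A : OAlgebra S) (σ : Involution A)
    (hA : A.IsAzumayaOfDegree n) (hσ : σ.IsOrthogonal) :
    EtaleLocally S fun c ↦ IsIsomorphic (σ.pull c) (trInvolution n c.R) := by
  intro s
  obtain ⟨c, ⟨q, rfl⟩, hc⟩ := hσ s
  obtain ⟨Ω, _, _, φ, hφ⟩ := exists_geometric_point q
  obtain ⟨R', _, _, φ', k, _, hφ', h⟩ := exists_etale_isIsomorphic_tr (c.isUnit_two h2) φ hc
  let _ : Algebra Γ(S, c.V) R' := ((algebraMap c.R R').comp (algebraMap Γ(S, c.V) c.R)).toAlgebra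
  have : IsScalarTower Γ(S, c.V) c.R R' := .of_algebraMap_eq fun _ ↦ rfl
  have : Algebra.Etale Γ(S, c.V) R' := .comp _ c.R _
  have h' : IsIsomorphic ((σ.app c.V).baseChange R') (trInvolution k R') :=
    (isIsomorphic_baseChange_baseChange (σ.app c.V) c.R R').trans h
  have : Nonempty (PrimeSpectrum (c.refine R').R) :=
    ⟨⟨RingHom.ker φ', RingHom.ker_isPrime φ'⟩⟩
  obtain rfl := hA.eq_degree (c.refine R') ⟨h'.choose.toLinearEquiv⟩
  exact ⟨c.refine R', c.map_mem_range_refine R' hφ φ' hφ', h'⟩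

theorem etaleLocally_sp [Nonempty S] (h2 : IsUnit (2 : Γ(S, ⊤))) {n : ℕ} (A : OAlgebra S)
    (σ : Involution A) (hA : A.IsAzumayaOfDegree n) (hσ : σ.IsSymplectic) :
    ∃ m : ℕ, n = 2 * m ∧
      EtaleLocally S fun c ↦ IsIsomorphic (σ.pull c) (spInvolution m c.R) := by
  have key : ∀ s : S, ∃ m : ℕ, n = 2 * m ∧ ∃ c : EtaleChart S, s ∈ Set.range c.map ∧
      IsIsomorphic (σ.pull c) (spInvolution m c.R) := by
    intro s
    obtain ⟨c, ⟨q, rfl⟩, hc⟩ := hσ s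
    obtain ⟨Ω, _, _, φ, hφ⟩ := exists_geometric_point q
    obtain ⟨R', _, _, φ', m, _, hφ', h⟩ := exists_etale_isIsomorphic_sp (c.isUnit_two h2) φ hc
    let _ : Algebra Γ(S, c.V) R' := ((algebraMap c.R R').comp (algebraMap Γ(S, c.V) c.R)).toAlgebra
    have : IsScalarTower Γ(S, c.V) c.R R' := .of_algebraMap_eq fun _ ↦ rfl
    have : Algebra.Etale Γ(S, c.V) R' := .comp _ c.R _
    have h' : IsIsomorphic ((σ.app c.V).baseChange R') (spInvolution m R') :=
      (isIsomorphic_baseChange_baseChange (σ.app c.V) c.R R').trans h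
    have : Nonempty (PrimeSpectrum (c.refine R').R) :=
      ⟨⟨RingHom.ker φ', RingHom.ker_isPrime φ'⟩⟩
    have hn := hA.eq_degree (k := m + m) (c.refine R') ⟨h'.choose.toLinearEquiv.trans
      (Matrix.reindexLinearEquiv R' R' finSumFinEquiv finSumFinEquiv)⟩
    exact ⟨m, by lia, c.refine R', c.map_mem_range_refine R' hφ φ' hφ', h'⟩
  -- The integer found at each point satisfies `n = 2 * m`, so it is the same everywhere.
  obtain ⟨m, hm, -⟩ := key (Classical.arbitrary S)
  refine ⟨m, hm, fun s ↦ ?_⟩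
  obtain ⟨m', hm', h⟩ := key s
  obtain rfl : m' = m := by lia
  exact h

end

section

/-! ## Unitary involutions over split quadratic étale algebras -/

section Exchange

variable {K B R : Type u} [CommRing K] [CommRing B] [CommRing R] [Algebra K B] [Algebra K R]
  [Algebra B R] [IsScalarTower K B R] (τ : B →ₐ[K] B)

/-- The comparison `R ⊗ B → R × R` given by a `B`-algebra structure on `R` and its conjugate. -/
def conjPair : R ⊗[K] B →ₐ[R] R × R :=
  Algebra.TensorProduct.lift (Algebra.ofId R (R × R))
    ((IsScalarTower.toAlgHom K B R).prod ((IsScalarTower.toAlgHom K B R).comp τ))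
    fun _ _ ↦ Commute.all _ _

@[simp]
lemma conjPair_tmul (x : R) (b : B) :
    conjPair τ (x ⊗ₜ b) = (x * algebraMap B R b, x * algebraMap B R (τ b)) := by
  simp [conjPair, Algebra.ofId_apply]

/-- A surjection between finite projective modules of equal rank is bijective. For surjectivity, `1
⊗ b - τ b ⊗ 1` maps to `(b - τ b, 0)` and `b ⊗ 1 - 1 ⊗ b` to `(0, b - τ b)`, with `b - τ b` a unit
in `R`. -/
lemma conjPair_bijective [Module.Finite K B] [Module.Flat K B]
    (hrk : ∀ p, Module.rankAtStalk (R := K) B p = 2) (b : B)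
    (hb : IsUnit (algebraMap B R (b - τ b))) :
    Function.Bijective (conjPair (R := R) τ) := by
  obtain ⟨w, hw⟩ := hb.exists_right_inv
  rw [map_sub] at hw
  refine Module.bijective_of_surjective_of_rankAtStalk_eq
    (φ := (conjPair (R := R) τ).toLinearMap) ?_ fun m _ ↦ ?_
  · rintro ⟨x, y⟩
    refine ⟨(x * w) • (1 ⊗ₜ b - algebraMap B R (τ b) ⊗ₜ 1) +
      (y * w) • (algebraMap B R b ⊗ₜ 1 - 1 ⊗ₜ b), ?_⟩
    simp only [AlgHom.toLinearMap_apply, map_add, map_smul, map_sub, conjPair_tmul, map_one,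
      one_mul, mul_one]
    ext <;> simp
    · linear_combination x * hw
    · linear_combination y * hw
  · have : Nontrivial R := PrimeSpectrum.nontrivial (⟨m, inferInstance⟩ : PrimeSpectrum R)
    rw [Module.rankAtStalk_baseChange, hrk, Module.rankAtStalk_prod]
    simp

variable {C : Type u} [Ring C] [Algebra K C] [Algebra B C] [IsScalarTower K B C]

/-- The idempotent `(1, 0)` of `R × R ≃ R ⊗[K] B` gives a central idempotent `j ε` of `R ⊗[K] C`.
Its factor is `R ⊗[B] C`, hence `M_n(R)`, and the involution `s` sends `j ε` to `1 - j ε`. Thus `z ↦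
(q z, q (s z))` identifies the whole with `M_n × M_nᵒᵖ`, and applying `s` swaps the entries. -/
theorem isIsomorphic_exchange [Module.Finite K B] [Module.Flat K B]
    (hrk : ∀ p, Module.rankAtStalk (R := K) B p = 2) (b₀ : B)
    (hb₀ : IsUnit (algebraMap B R (b₀ - τ b₀)))
    (hττ : ∀ b, τ (τ b) = b) (σ : C →ₗ[K] C) (hσ1 : σ 1 = 1)
    (hσm : ∀ x y, σ (x * y) = σ y * σ x)
    (hσσ : ∀ x, σ (σ x) = x) (hστ : ∀ b, σ (algebraMap B C b) = algebraMap B C (τ b)) {n : ℕ}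
    (e : R ⊗[B] C ≃ₐ[R] Matrix (Fin n) (Fin n) R) :
    IsIsomorphic (σ.baseChange R) (exchangeInvolution n R) := by
  have hθ := conjPair_bijective τ hrk b₀ hb₀
  obtain ⟨ε, hε⟩ := hθ.2 (1, 0)
  let j : R ⊗[K] B →ₐ[R] R ⊗[K] C :=
    Algebra.TensorProduct.map (AlgHom.id R R) (IsScalarTower.toAlgHom K B C)
  have hj : ∀ x b, j (x ⊗ₜ b) = x ⊗ₜ algebraMap B C b := fun x b ↦ by simp [j]
  let s := σ.baseChange R
  have hsm : ∀ x y, s (x * y) = s y * s x := by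
    intro x y
    induction x with
    | zero => simp
    | add x x' hx hx' => simp only [add_mul, mul_add, map_add, hx, hx']
    | tmul a c =>
      induction y with
      | zero => simp
      | add y y' hy hy' => simp only [add_mul, mul_add, map_add, hy, hy']
      | tmul a' c' => simp [s, hσm, mul_comm a]
  have hss : ∀ x, s (s x) = x := by
    intro x
    induction x with
    | zero => simp
    | add x x' hx hx' => simp only [map_add, hx, hx']
    | tmul a c => simp [s, hσσ]
  have hcomm : ∀ y z, j y * z = z * j y := by
    intro y z
    induction y with
    | zero => simp
    | add y y' hy hy' => simp only [map_add, add_mul, mul_add, hy, hy']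
    | tmul a b =>
      induction z with
      | zero => simp
      | add z z' hz hz' => simp only [add_mul, mul_add, hz, hz']
      | tmul a' c => simp [hj, mul_comm a, Algebra.commutes]
  have hε1 : ∀ y, ε * y = ε * ((conjPair τ y).1 ⊗ₜ 1) := by
    intro y
    apply hθ.1
    ext <;> simp [hε]
  have hsj : ∀ y, s (j y) = j (τ.toLinearMap.baseChange R y) := by
    intro y
    induction y with
    | zero => simp
    | add y y' hy hy' => simp only [map_add, hy, hy']
    | tmul a b => simp [s, hj, hστ]
  have hθτ : ∀ y, conjPair τ (τ.toLinearMap.baseChange R y) = (conjPair (R := R) τ y).swap := by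
    intro y
    induction y with
    | zero => simp
    | add y y' hy hy' => simp only [map_add, hy, hy', Prod.swap_add]
    | tmul a b => simp [hττ]
  have hsE : s (j ε) = 1 - j ε := by
    rw [hsj, ← map_one j, ← map_sub]
    congr 1
    apply hθ.1
    rw [hθτ, map_sub, hε, map_one]
    ext <;> simp
  let q : R ⊗[K] C →ₐ[R] R ⊗[B] C := Algebra.TensorProduct.mapOfCompatibleSMul B K R R C
  have hq : Function.Surjective q := Algebra.TensorProduct.mapOfCompatibleSMul_surjective B K R R C
  have hqj : ∀ y, q (j y) = (conjPair τ y).1 ⊗ₜ 1 := by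
    intro y
    induction y with
    | zero => simp
    | add y y' hy hy' => simp only [map_add, hy, hy', Prod.fst_add, TensorProduct.add_tmul]
    | tmul a b =>
      simp only [hj, q, Algebra.TensorProduct.mapOfCompatibleSMul_tmul, conjPair_tmul]
      rw [Algebra.algebraMap_eq_smul_one, TensorProduct.tmul_smul, TensorProduct.smul_tmul',
        Algebra.smul_def, mul_comm]
  have hqE : q (j ε) = 1 := by rw [hqj, hε]; rfl
  have hqsE : q (s (j ε)) = 0 := by rw [hsE, map_sub, hqE, map_one, sub_self]
  -- Multiplication by `j ε` factors through `q`, because `b` acts on that factor through its image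
  -- in `R`. Hence `q z = 0` forces `j ε * z = 0`.
  have hψ : ∃ ψ : R ⊗[B] C →+ R ⊗[K] C, ∀ z, ψ (q z) = j ε * z := by
    let f : R →+ C →+ R ⊗[K] C :=
      { toFun x :=
          { toFun c := j ε * (x ⊗ₜ c)
            map_zero' := by simp
            map_add' := by simp [TensorProduct.tmul_add, mul_add] }
        map_zero' := by ext; simp
        map_add' _ _ := by ext; simp [TensorProduct.add_tmul, mul_add] }
    refine ⟨TensorProduct.liftAddHom f fun b x c ↦ ?_, fun z ↦ ?_⟩
    · have h1 : j ε * j (1 ⊗ₜ b) = j ε * j (algebraMap B R b ⊗ₜ 1) := by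
        rw [← map_mul, ← map_mul, hε1]
        simp
      change j ε * ((b • x) ⊗ₜ c) = j ε * (x ⊗ₜ (b • c))
      have h2 : (b • x) ⊗ₜ[K] c = j (algebraMap B R b ⊗ₜ 1) * (x ⊗ₜ c) := by
        simp [hj, Algebra.smul_def]
      have h3 : x ⊗ₜ[K] (b • c) = j (1 ⊗ₜ b) * (x ⊗ₜ c) := by
        simp [hj, Algebra.smul_def]
      rw [h2, h3, ← mul_assoc, ← mul_assoc, h1]
    · induction z with
      | zero => simp
      | add z z' hz hz' => simp only [map_add, mul_add, hz, hz']
      | tmul x c => simp [q, f]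
  obtain ⟨ψ, hψ⟩ := hψ
  let Ψ : R ⊗[K] C →ₐ[R] Matrix (Fin n) (Fin n) R × (Matrix (Fin n) (Fin n) R)ᵐᵒᵖ :=
    AlgHom.ofLinearMap
      ((e.toLinearMap ∘ₗ q.toLinearMap).prod
        ((MulOpposite.opLinearEquiv R).toLinearMap ∘ₗ e.toLinearMap ∘ₗ q.toLinearMap ∘ₗ s))
      (by
        have : s 1 = 1 := by rw [Algebra.TensorProduct.one_def]; simp [s, hσ1]
        ext1 <;> simp [this])
      (fun x y ↦ by ext1 <;> simp [hsm])
  have hΨ : ∀ z, Ψ z = (e (q z), MulOpposite.op (e (q (s z)))) := fun _ ↦ rfl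
  have hbij : Function.Bijective Ψ := by
    constructor
    · rw [injective_iff_map_eq_zero]
      intro z hz
      rw [hΨ, Prod.mk_eq_zero, MulOpposite.op_eq_zero_iff, map_eq_zero_iff e e.injective,
        map_eq_zero_iff e e.injective] at hz
      have h1 : j ε * z = 0 := by rw [← hψ, hz.1, map_zero]
      have h2 : j ε * s z = 0 := by rw [← hψ, hz.2, map_zero]
      have h3 := congr_arg s h2
      rw [hsm, hss, hsE, map_zero, mul_sub, mul_one, ← hcomm, h1, sub_zero] at h3
      exact h3
    · rintro ⟨X, Y⟩
      obtain ⟨z₁, hz₁⟩ := hq (e.symm X)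
      obtain ⟨z₂, hz₂⟩ := hq (e.symm Y.unop)
      refine ⟨j ε * z₁ + s (j ε * z₂), ?_⟩
      have hz₁' : e (q z₁) = X := by simp [q, hz₁]
      have hz₂' : e (q z₂) = Y.unop := by simp [q, hz₂]
      rw [hΨ, map_add, map_add, map_add, hss, hsm, hsm]
      simp only [map_add, map_mul, hqE, hqsE, map_zero, one_mul, mul_zero, add_zero,
        zero_add, hz₁', hz₂', MulOpposite.op_unop]
  exact ⟨AlgEquiv.ofBijective Ψ hbij, fun z ↦ by
    change Ψ (s z) = exchangeInvolution n R (Ψ z)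
    rw [hΨ, hΨ, hss]
    rfl⟩

end Exchange

end

section

/-! ## The locus where the involution of a quadratic étale covering is trivial -/

section Fixed

open Limits

variable {S T : Scheme.{u}} {π : T ⟶ S} {τ : T ⟶ T}

/-- The diagonal of a finite étale `π` is an open and closed immersion, so the locus where `τ` is
the identity is open and closed in `T`. As `π` is open and closed, so is the set `V` of points whose
whole fibre lies in that locus; `nontrivial` makes it empty. The condition concerns `Spec κ(t) ⟶ T`
because `τ` may fix `t` and still move its residue field. -/
lemma IsQuadraticEtale.exists_moved_point (h : IsQuadraticEtale π τ) (s : S) :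
    ∃ t : T, π t = s ∧ T.fromSpecResidueField t ≫ τ ≠ T.fromSpecResidueField t := by
  have := h.finite
  have := h.etale
  let d : T ⟶ pullback π π := pullback.lift τ (𝟙 T) (by simp [h.comp_eq])
  let i := pullback.snd (pullback.diagonal π) d
  have hi : i ≫ τ = i := by
    have h1 := congr_arg (· ≫ pullback.fst π π) (pullback.condition (f := pullback.diagonal π) (g := d))
    have h2 := congr_arg (· ≫ pullback.snd π π) (pullback.condition (f := pullback.diagonal π) (g := d))
    simp only [Category.assoc, pullback.diagonal_fst, pullback.diagonal_snd, Category.comp_id, d,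
      pullback.lift_fst, pullback.lift_snd] at h1 h2
    exact h1.symm.trans h2
  have hopen : IsOpen (Set.range i) := i.isOpenEmbedding.isOpen_range
  have hclosed : IsClosed (Set.range i) := i.isClosedEmbedding.isClosed_range
  by_contra! hcon
  let V : S.Opens := ⟨(π '' (Set.range i)ᶜ)ᶜ, (π.isClosedMap _ hopen.isClosed_compl).isOpen_compl⟩
  refine h.nontrivial V (π.isOpenMap _ hclosed.isOpen_compl).isClosed_compl ?_ ?_
  · have hs : s ∈ V := by
      rintro ⟨t, ht, rfl⟩
      have hg := hcon t rfl
      apply ht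
      let g := T.fromSpecResidueField t
      let l : Spec (T.residueField t) ⟶ pullback (pullback.diagonal π) d :=
        pullback.lift g g (by
          apply pullback.hom_ext
          · rw [Category.assoc, Category.assoc, pullback.diagonal_fst, pullback.lift_fst,
              Category.comp_id]
            exact hg.symm
          · rw [Category.assoc, Category.assoc, pullback.diagonal_snd, pullback.lift_snd])
      obtain ⟨x, hx⟩ : t ∈ Set.range g := by simp [g]
      refine ⟨l x, ?_⟩
      rw [← Scheme.Hom.comp_apply, pullback.lift_snd, hx]
    intro hV
    rw [hV] at hs
    exact hs
  · have hle : Set.range (π ⁻¹ᵁ V).ι ⊆ Set.range i := by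
      rw [Scheme.Opens.range_ι]
      intro t ht
      by_contra hti
      exact ht ⟨t, hti, rfl⟩
    rw [← IsOpenImmersion.lift_fac i (π ⁻¹ᵁ V).ι hle, Category.assoc, hi]

/-- If every `b - τ b` vanished at `t`, then `Spec κ(t) ⟶ T` and its composite with `τ` would agree
on functions of the affine open `π ⁻¹ᵁ V`, which contains both images, so they would be equal. -/
lemma IsQuadraticEtale.exists_mem_basicOpen (h : IsQuadraticEtale π τ) {t : T} {V : S.Opens}
    (hV : IsAffineOpen V) (htV : π t ∈ V)
    (ht : T.fromSpecResidueField t ≫ τ ≠ T.fromSpecResidueField t) :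
    ∃ b : Γ(T, π ⁻¹ᵁ V), t ∈ T.basicOpen (b - act π τ h.comp_eq V b) := by
  have := h.finite
  have hU : IsAffineOpen (π ⁻¹ᵁ V) := hV.preimage π
  by_contra! hcon
  apply ht
  let g := T.fromSpecResidueField t
  have hgt : ∀ x, g x = t := fun x ↦ by simp [g]
  have hgU : (⊤ : (Spec (T.residueField t)).Opens) ≤ g ⁻¹ᵁ (π ⁻¹ᵁ V) := fun x _ ↦ by
    change π (g x) ∈ V
    rwa [hgt]
  have hgU' : (⊤ : (Spec (T.residueField t)).Opens) ≤ (g ≫ τ) ⁻¹ᵁ (π ⁻¹ᵁ V) := fun x _ ↦ by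
    change (g ≫ τ ≫ π) x ∈ V
    rw [h.comp_eq]
    exact hgU trivial
  have hτ : π ⁻¹ᵁ V ≤ τ ⁻¹ᵁ (π ⁻¹ᵁ V) := by rw [← Scheme.Hom.comp_preimage, h.comp_eq]
  have key : (g ≫ τ).appLE (π ⁻¹ᵁ V) ⊤ hgU' = g.appLE (π ⁻¹ᵁ V) ⊤ hgU := by
    rw [← Scheme.Hom.appLE_comp_appLE g τ _ (π ⁻¹ᵁ V) _ hτ hgU]
    ext b
    have h0 := hcon b
    have h1 : (g.appLE (π ⁻¹ᵁ V) ⊤ hgU).hom (b - act π τ h.comp_eq V b) = 0 := by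
      rw [← basicOpen_eq_bot_iff, Scheme.basicOpen_appLE, eq_bot_iff]
      intro x hx
      apply h0
      rw [← hgt x]
      exact hx.2
    rw [map_sub, sub_eq_zero] at h1
    exact h1.symm
  have ha : IsAffineOpen (⊤ : (Spec (T.residueField t)).Opens) := isAffineOpen_top _
  have e1 := hU.SpecMap_appLE_fromSpec (g ≫ τ) ha hgU'
  have e2 := hU.SpecMap_appLE_fromSpec g ha hgU
  rw [key, e2] at e1
  have : IsIso ha.fromSpec := by rw [IsAffineOpen.fromSpec_top]; infer_instance
  exact ((cancel_epi ha.fromSpec).mp e1).symm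

end Fixed

end

section

/-! ## Unitary involutions are étale locally exchange involutions -/

/-- Split forms can be transported between two charts with a common refinement. -/
lemma nonempty_algEquiv_matrix {B B' G R' R C C' D : Type u} [CommRing B] [CommRing B'] [CommRing G]
    [CommRing R'] [CommRing R] [Ring C] [Ring C'] [Ring D] [Algebra B G] [Algebra B' G]
    [Algebra B' R'] [Algebra G R] [Algebra R' R] [Algebra B R] [Algebra B' R]
    [IsScalarTower B G R] [IsScalarTower B' G R] [IsScalarTower B' R' R]
    [Algebra B C] [Algebra B' C'] [Algebra G D] (e₁ : G ⊗[B] C ≃ₐ[G] D) (e₂ : G ⊗[B'] C' ≃ₐ[G] D)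
    {n : ℕ} (e₃ : R' ⊗[B'] C' ≃ₐ[R'] Matrix (Fin n) (Fin n) R') :
    Nonempty (R ⊗[B] C ≃ₐ[R] Matrix (Fin n) (Fin n) R) :=
  ⟨(cancelBaseChange B G R C).symm.trans <|
    (Algebra.TensorProduct.congr .refl (e₁.trans e₂.symm)).trans <|
    (cancelBaseChange B' G R C').trans <|
    (cancelBaseChange B' R' R C').symm.trans <|
    (Algebra.TensorProduct.congr .refl e₃).trans (matrixBaseChange R' R n)⟩

/-- The splitting chart at `t` lives over an affine open unrelated to `U`. Shrinking to a `W` that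
is basic open in both, quasi-coherence transports the splitting to `A.sections U`. -/
lemma OAlgebra.IsAzumayaOfDegree.exists_split {T : Scheme.{u}} {A : OAlgebra T} {n : ℕ}
    (hA : A.IsAzumayaOfDegree n) {U : T.Opens} (hU : IsAffineOpen U) (g : Γ(T, U)) {t : T}
    (ht : t ∈ T.basicOpen g) :
    ∃ (W : T.Opens) (hW : IsAffineOpen W) (hWU : W ≤ U) (_ : W ≤ T.basicOpen g)
      (R : Type u) (_ : CommRing R) (_ : Algebra Γ(T, W) R) (_ : Algebra Γ(T, U) R)
      (p : PrimeSpectrum R), Algebra.Etale Γ(T, W) R ∧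
      algebraMap Γ(T, U) R = (algebraMap Γ(T, W) R).comp (resΓ T hWU) ∧
      hW.fromSpec (p.comap (algebraMap Γ(T, W) R)) = t ∧
      Nonempty (R ⊗[Γ(T, U)] A.sections U ≃ₐ[R] Matrix (Fin n) (Fin n) R) := by
  obtain ⟨c, ⟨q, rfl⟩, ⟨e⟩⟩ := hA.degree t
  have hq := c.map_apply q
  have htV : c.map q ∈ c.V := by
    rw [hq, ← SetLike.mem_coe, ← c.isAffineOpen.range_fromSpec]; exact ⟨_, rfl⟩
  obtain ⟨f₁, f', hf₁, htf⟩ :=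
    exists_basicOpen_le_affine_inter (hU.basicOpen g) c.isAffineOpen _ ⟨ht, htV⟩
  obtain ⟨f, hf⟩ := hU.basicOpen_basicOpen_is_basicOpen g f₁
  generalize hW : T.basicOpen f = W at hf
  have hWa : IsAffineOpen W := hW ▸ hU.basicOpen f
  have hWU : W ≤ U := hW ▸ T.basicOpen_le f
  have hWV : W ≤ c.V := (hf.trans hf₁).trans_le (T.basicOpen_le f')
  let _ : Algebra Γ(T, U) Γ(T, W) := (resΓ T hWU).toAlgebra
  let _ : Algebra Γ(T, c.V) Γ(T, W) := (resΓ T hWV).toAlgebra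
  obtain ⟨e₁, -⟩ := hA.locallyFree.exists_restrictEquiv hU f hWU hW.symm rfl
  obtain ⟨e₂, -⟩ := hA.locallyFree.exists_restrictEquiv c.isAffineOpen f' hWV (hf.trans hf₁) rfl
  let R := Γ(T, W) ⊗[Γ(T, c.V)] c.R
  let _ : Algebra c.R R := Algebra.TensorProduct.rightAlgebra
  have hloc : IsLocalization.Away f' Γ(T, W) :=
    c.isAffineOpen.isLocalization_of_eq_basicOpen f' (homOfLE hWV) (hf.trans hf₁)
  obtain ⟨Ω, _, _, φ, hφ⟩ := exists_geometric_point q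
  have hφf : φ (algebraMap Γ(T, c.V) c.R f') ≠ 0 := by
    intro h0
    have h1 : q.comap (algebraMap Γ(T, c.V) c.R) ∈ PrimeSpectrum.basicOpen f' := by
      rw [← c.isAffineOpen.fromSpec_preimage_basicOpen f', ← hf₁]
      change c.isAffineOpen.fromSpec (q.comap (algebraMap Γ(T, c.V) c.R)) ∈ T.basicOpen f₁
      rwa [← hq]
    apply h1
    change algebraMap Γ(T, c.V) c.R f' ∈ q.asIdeal
    rw [← hφ]
    exact h0
  let _ : Algebra Γ(T, c.V) Ω := (φ.comp (algebraMap Γ(T, c.V) c.R)).toAlgebra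
  -- The geometric point of `c.R` does not kill `f'`, so it extends to `R`; the kernel of the
  -- extension is a prime `p` of `R` above `t`.
  let ψ : Γ(T, W) →ₐ[Γ(T, c.V)] Ω :=
    { IsLocalization.Away.lift f' (g := algebraMap Γ(T, c.V) Ω) (isUnit_iff_ne_zero.mpr hφf) with
      commutes' := fun x ↦ IsLocalization.Away.lift_eq f' _ x }
  let χ : R →+* Ω := (Algebra.TensorProduct.lift ψ
    ({ φ with commutes' := fun _ ↦ rfl } : c.R →ₐ[Γ(T, c.V)] Ω) fun _ _ ↦ .all _ _).toRingHom
  have hχ : χ.comp (algebraMap c.R R) = φ := by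
    ext x
    simp [χ, R, Algebra.TensorProduct.right_algebraMap_apply]
  let p : PrimeSpectrum R := ⟨RingHom.ker χ, RingHom.ker_isPrime χ⟩
  have hp : p.comap (algebraMap c.R R) = q := by
    ext1
    rw [← hφ, ← hχ]
    rfl
  refine ⟨W, hWa, hWU, ?_, R, inferInstance, inferInstance, inferInstance, p, inferInstance, rfl,
    ?_, nonempty_algEquiv_matrix e₁ e₂ e⟩
  · exact hf.trans_le (T.basicOpen_le f₁)
  · rw [hq, ← hp, ← PrimeSpectrum.comap_comp_apply, ← IsScalarTower.algebraMap_eq,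
      IsScalarTower.algebraMap_eq Γ(T, c.V) Γ(T, W) R, PrimeSpectrum.comap_comp_apply,
      ← c.isAffineOpen.map_fromSpec hWa (homOfLE hWV).op]
    rfl

variable {S T : Scheme.{u}} {π : T ⟶ S} {τ : T ⟶ T}

/-- Over an affine open `V`, the map of spectra is the base change of `π`, and the degree is stable
under base change. -/
lemma IsQuadraticEtale.rankAtStalk_eq (h : IsQuadraticEtale π τ) {V : S.Opens}
    (hV : IsAffineOpen V) [Algebra Γ(S, V) Γ(T, π ⁻¹ᵁ V)]
    (halg : algebraMap Γ(S, V) Γ(T, π ⁻¹ᵁ V) = (π.app V).hom)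
    [Module.Finite Γ(S, V) Γ(T, π ⁻¹ᵁ V)] [Module.Flat Γ(S, V) Γ(T, π ⁻¹ᵁ V)]
    (p : PrimeSpectrum Γ(S, V)) : Module.rankAtStalk Γ(T, π ⁻¹ᵁ V) p = 2 := by
  have := h.finite
  have := h.etale
  have hU : IsAffineOpen (π ⁻¹ᵁ V) := hV.preimage π
  have hpb : IsPullback hU.fromSpec (Spec.map (π.app V)) π hV.fromSpec := by
    refine (IsOpenImmersion.isPullback _ _ _ _ ?_ ?_).flip
    · rw [Scheme.Hom.app_eq_appLE]
      exact (hV.SpecMap_appLE_fromSpec π hU le_rfl).symm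
    · ext1
      simp [IsAffineOpen.opensRange_fromSpec]
  have h1 := Scheme.Hom.finrank_of_isPullback _ _ _ _ hpb p
  rw [h.degree] at h1
  rw [← h1, ← Scheme.Hom.finrank_SpecMap_algebraMap, halg]
  rfl

theorem etaleLocally_exchange (h : IsQuadraticEtale π τ) {n : ℕ} (A : OAlgebra T)
    (σ : Involution (A.pushforward π)) (hA : A.IsAzumayaOfDegree n) (hσ : IsUnitary π τ h σ) :
    EtaleLocally S fun c ↦ IsIsomorphic (σ.pull c) (exchangeInvolution n c.R) := by
  have := h.finite
  have := h.etale
  intro s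
  obtain ⟨t, rfl, ht⟩ := h.exists_moved_point s
  obtain ⟨V, hV, htV, -⟩ := exists_isAffineOpen_mem_and_subset (x := π t) (U := ⊤) trivial
  obtain ⟨b, hb⟩ := h.exists_mem_basicOpen hV htV ht
  have hU : IsAffineOpen (π ⁻¹ᵁ V) := hV.preimage π
  obtain ⟨W, hW, hWU, hWb, R, _, _, _, p, _, hR, hp, ⟨e⟩⟩ := hA.exists_split hU _ hb
  let _ : Algebra Γ(S, V) Γ(T, π ⁻¹ᵁ V) := (π.app V).hom.toAlgebra
  let _ : Algebra Γ(S, V) Γ(T, W) := (π.appLE V W hWU).hom.toAlgebra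
  let _ : Algebra Γ(S, V) R :=
    ((algebraMap Γ(T, W) R).comp (algebraMap Γ(S, V) Γ(T, W))).toAlgebra
  have : IsScalarTower Γ(S, V) Γ(T, W) R := .of_algebraMap_eq fun _ ↦ rfl
  have : IsScalarTower Γ(S, V) Γ(T, π ⁻¹ᵁ V) R := .of_algebraMap_eq fun x ↦ by
    rw [hR]
    rfl
  -- Since `π` is étale, the splitting neighbourhood of `t` in `T` is itself a chart of `S` at `π
  -- t`.
  have : Algebra.Etale Γ(S, V) Γ(T, W) :=
    RingHom.etale_algebraMap.mp (HasRingHomProperty.appLE @Etale π ‹_› ⟨V, hV⟩ ⟨W, hW⟩ hWU)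
  have : Algebra.Etale Γ(S, V) R := .comp _ Γ(T, W) _
  have : Module.Finite Γ(S, V) Γ(T, π ⁻¹ᵁ V) := π.finite_app V hV
  have : Module.Flat Γ(S, V) Γ(T, π ⁻¹ᵁ V) := by
    have := HasRingHomProperty.appLE @Flat π inferInstance ⟨V, hV⟩ ⟨_, hU⟩ le_rfl
    rw [Scheme.Hom.appLE_eq_app] at this
    exact this
  let c : EtaleChart S := { V := V, isAffineOpen := hV, R := R }
  refine ⟨c, ⟨p, ?_⟩, ?_⟩
  · rw [c.map_apply, ← hp]
    change hV.fromSpec (p.comap (algebraMap Γ(S, V) R)) = _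
    rw [IsScalarTower.algebraMap_eq Γ(S, V) Γ(T, W) R, PrimeSpectrum.comap_comp_apply]
    exact congr_arg (fun f : Spec Γ(T, W) ⟶ S ↦ f (p.comap (algebraMap Γ(T, W) R)))
      (hV.SpecMap_appLE_fromSpec π hW hWU)
  · let _ : Algebra Γ(S, V) (A.sections (π ⁻¹ᵁ V)) :=
      show Algebra Γ(S, V) ((A.pushforward π).sections V) from inferInstance
    have : IsScalarTower Γ(S, V) Γ(T, π ⁻¹ᵁ V) (A.sections (π ⁻¹ᵁ V)) :=
      .of_algebraMap_eq fun _ ↦ rfl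
    have := (hA.azumaya _ hU).toFaithfulSMul
    let τ' : Γ(T, π ⁻¹ᵁ V) →ₐ[Γ(S, V)] Γ(T, π ⁻¹ᵁ V) :=
      { act π τ h.comp_eq V with
        commutes' := fun x ↦ by
          change (π.app V ≫ τ.appLE (π ⁻¹ᵁ V) (π ⁻¹ᵁ V) _).hom x = (π.app V).hom x
          simp_rw [Scheme.Hom.app_eq_appLE, Scheme.Hom.appLE_comp_appLE, h.comp_eq] }
    let σ' : A.sections (π ⁻¹ᵁ V) →ₗ[Γ(S, V)] A.sections (π ⁻¹ᵁ V) := σ.app V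
    have hστ : ∀ x, σ' (algebraMap Γ(T, π ⁻¹ᵁ V) (A.sections (π ⁻¹ᵁ V)) x) =
      algebraMap Γ(T, π ⁻¹ᵁ V) (A.sections (π ⁻¹ᵁ V)) (τ' x) := hσ V
    refine isIsomorphic_exchange (C := A.sections (π ⁻¹ᵁ V)) τ' (h.rankAtStalk_eq hV rfl) b ?_ (fun x ↦ ?_) σ'
      (σ.map_one V) (σ.map_mul V) (σ.app_app V) hστ e
    · rw [hR]
      refine IsUnit.map (algebraMap Γ(T, W) R) ?_
      have := (T.toRingedSpace.isUnit_res_basicOpen (b - act π τ h.comp_eq V b)).map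
        (OAlgebra.resΓ T hWb)
      exact (OAlgebra.resΓ_resΓ hWb (T.basicOpen_le _) _) ▸ this
    -- `τ ∘ τ = id` on functions is inherited from `σ ∘ σ = id`, as functions embed in the Azumaya
    -- algebra.
    · apply FaithfulSMul.algebraMap_injective Γ(T, π ⁻¹ᵁ V) (A.sections (π ⁻¹ᵁ V))
      rw [← hστ, ← hστ]
      exact σ.app_app V _

end

end AzumayaInvolution

end

theorem mainTheorem5 (S : Scheme.{u}) [Nonempty S] (h2 : IsUnit (2 : Γ(S, ⊤))) (n : ℕ) :
    (∀ (A : AzumayaInvolution.OAlgebra S) (σ : AzumayaInvolution.Involution A),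
      A.IsAzumayaOfDegree n → σ.IsOrthogonal →
      AzumayaInvolution.EtaleLocally S fun c =>
        AzumayaInvolution.IsIsomorphic (σ.pull c) (AzumayaInvolution.trInvolution n c.R)) ∧
    (∀ (A : AzumayaInvolution.OAlgebra S) (σ : AzumayaInvolution.Involution A),
      A.IsAzumayaOfDegree n → σ.IsSymplectic →
      ∃ m : ℕ, n = 2 * m ∧ AzumayaInvolution.EtaleLocally S fun c =>
        AzumayaInvolution.IsIsomorphic (σ.pull c) (AzumayaInvolution.spInvolution m c.R)) ∧
    (∀ (T : Scheme.{u}) (π : T ⟶ S) (τ : T ⟶ T) (hτ : AzumayaInvolution.IsQuadraticEtale π τ)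
      (A : AzumayaInvolution.OAlgebra T)
      (σ : AzumayaInvolution.Involution (A.pushforward π)),
      A.IsAzumayaOfDegree n → AzumayaInvolution.IsUnitary π τ hτ σ →
      AzumayaInvolution.EtaleLocally S fun c =>
        AzumayaInvolution.IsIsomorphic (σ.pull c)
          (AzumayaInvolution.exchangeInvolution n c.R)) :=
  ⟨fun A σ hA hσ ↦ AzumayaInvolution.etaleLocally_tr h2 A σ hA hσ,
    fun A σ hA hσ ↦ AzumayaInvolution.etaleLocally_sp h2 A σ hA hσ,
    fun _ _ _ hτ A σ hA hσ ↦ AzumayaInvolution.etaleLocally_exchange hτ A σ hA hσ⟩
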